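/- For $a\in\mathbb R$ let $M^a=\dfrac{d^2}{dX^2}-a^2e^{2X}$ on $\mathbb R$ (the Bessel operator $L^a=x^2\frac{d^2}{dx^2}+x\frac{d}{dx}-a^2x^2$ on $(0,\infty)$ written in the variable $X=\ln x$). Consider the heat Cauchy problem with Morse potential $$\frac{\partial V}{\partial t}(t,X)=M^aV(t,X)\quad(t>0,\ X\in\mathbb R),\qquad V(0,X)=V_0(X),\qquad V_0\in C_c^\infty(\mathbb R;\mathbb C).$$ A classical solution is a function $V:[0,\infty)\times\mathbb R\to\mathbb C$ that is continuous on $[0,\infty)\times\mathbb R$, is of class $C^{1,2}$ on $(0,\infty)\times\mathbb R$ (the derivatives $\partial_tV,\partial_XV,\partial_X^2V$ exist and are continuous there), satisfies the equation for $t>0$, and takes the initial value $V_0$ at $t=0$. **Theorem.** For every $a\in\mathbb R$ and every $V_0\in C_c^\infty(\mathbb R;\mathbb C)$ the problem has exactly one classical solution satisfying the growth condition: for every $T>0$ there are constants $C,c$ with $|V(t,X)|\le Ce^{cX^2}$ for all $0\le t\le T$, $X\in\mathbb R$. For $t>0$ it is given by $$V(t,X)=\int_{\mathbb R}K_a(t,X,X')\,V_0(X')\,dX',$$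 $$K_a(t,X,X')=\frac{1}{4\sqrt\pi\,t^{3/2}}\int_{|X-X'|}^\infty s\,e^{-s^2/4t}\,J_0\!\left(2|a|e^{(X+X')/2}\sqrt{\cosh^2\tfrac s2-\cosh^2\tfrac{X-X'}2}\right)ds,$$ where $J_0(z)=\sum_{k\ge0}\frac{(-1)^k(z/2)^{2k}}{(k!)^2}$ is the Bessel function of the first kind of order $0$, and both integrals converge absolutely. -/

import Mathlib

open Set MeasureTheory
open scoped ContDiff

noncomputable section

namespace MorseHeat

/-- The Bessel operator `L^a = x² d²/dx² + x d/dx - a² x²` on `(0, ∞)`. -/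
def besselOperator (a : ℝ) (f : ℝ → ℂ) (x : ℝ) : ℂ :=
  (x : ℂ) ^ 2 * deriv (deriv f) x + (x : ℂ) * deriv f x - (a : ℂ) ^ 2 * (x : ℂ) ^ 2 * f x

/-- The Schrödinger operator with Morse potential `M^a = d²/dX² - a² e^{2X}` on the real line. -/
def morseOperator (a : ℝ) (g : ℝ → ℂ) (X : ℝ) : ℂ :=
  deriv (deriv g) X - ((a ^ 2 * Real.exp (2 * X) : ℝ) : ℂ) * g X

/-- `M^a` is the Bessel operator `L^a` written in the variable `X = ln x`. -/
theorem besselOperator_comp_log (a : ℝ) (g : ℝ → ℂ) (hg : ContDiff ℝ 2 g) (x : ℝ) (hx : 0 < x) :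
    besselOperator a (fun y => g (Real.log y)) x = morseOperator a g (Real.log x) := by
  have hd1 : Differentiable ℝ g := hg.differentiable (by norm_num)
  have hd2 : Differentiable ℝ (deriv g) := by
    have h : ContDiff ℝ (1 + 1) g := by norm_num; exact hg
    exact (contDiff_succ_iff_deriv.1 h).2.2.differentiable (by norm_num)
  have key : ∀ y : ℝ, 0 < y →
      HasDerivAt (fun z => g (Real.log z)) (y⁻¹ • deriv g (Real.log y)) y := fun y hy =>
    HasDerivAt.scomp y (hd1 (Real.log y)).hasDerivAt (Real.hasDerivAt_log hy.ne')
  have e1 : deriv (fun z => g (Real.log z)) =ᶠ[nhds x]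
      fun y => y⁻¹ • deriv g (Real.log y) := by
    filter_upwards [lt_mem_nhds hx] with y hy using (key y hy).deriv
  have h2 : HasDerivAt (fun y : ℝ => y⁻¹ • deriv g (Real.log y))
      (x⁻¹ • (x⁻¹ • deriv (deriv g) (Real.log x)) + (-(x ^ 2)⁻¹) • deriv g (Real.log x)) x :=
    (hasDerivAt_inv hx.ne').smul
      (HasDerivAt.scomp x (hd2 (Real.log x)).hasDerivAt (Real.hasDerivAt_log hx.ne'))
  have hxc : (x : ℂ) ≠ 0 := by exact_mod_cast hx.ne'
  have hexp : Real.exp (2 * Real.log x) = x ^ 2 := by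
    rw [two_mul, Real.exp_add, Real.exp_log hx, sq]
  unfold besselOperator morseOperator
  rw [e1.deriv_eq, h2.deriv, (key x hx).deriv, hexp]
  simp only [Complex.real_smul]
  push_cast
  field_simp
  ring

/-- The Bessel function of the first kind of order zero,
`J₀(z) = ∑ (-1)^k (z/2)^{2k} / (k!)²`, for real `z`. -/
def besselJ0 (z : ℝ) : ℝ :=
  ∑' k : ℕ, (-1 : ℝ) ^ k * (z / 2) ^ (2 * k) / ((k.factorial : ℝ) ^ 2)

/-- The series that defines `J₀` converges absolutely for every `z`. -/
theorem summable_besselJ0 (z : ℝ) :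
    Summable fun k : ℕ => (-1 : ℝ) ^ k * (z / 2) ^ (2 * k) / ((k.factorial : ℝ) ^ 2) := by
  refine Summable.of_norm_bounded (Real.summable_pow_div_factorial ((z / 2) ^ 2)) fun k => ?_
  have h1 : (1 : ℝ) ≤ k.factorial := by exact_mod_cast k.factorial_pos
  rw [norm_div, norm_mul, norm_pow, norm_pow, norm_neg, norm_one, one_pow, one_mul, pow_mul,
    Real.norm_eq_abs, sq_abs, norm_pow, Real.norm_of_nonneg (by positivity)]
  gcongr
  nlinarith

/-- The integrand `s e^{-s²/4t} J₀(2|a| e^{(X+X')/2} √(cosh²(s/2) - cosh²((X-X')/2)))`. -/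
def heatIntegrand (a t X X' s : ℝ) : ℝ :=
  s * Real.exp (-s ^ 2 / (4 * t)) *
    besselJ0 (2 * |a| * Real.exp ((X + X') / 2) *
      Real.sqrt (Real.cosh (s / 2) ^ 2 - Real.cosh ((X - X') / 2) ^ 2))

/-- The heat kernel `K_a(t, X, X')` with Morse potential, for `t > 0`. -/
def heatKernel (a t X X' : ℝ) : ℝ :=
  1 / (4 * Real.sqrt Real.pi * t ^ (3 / 2 : ℝ)) *
    ∫ s in Ioi |X - X'|, heatIntegrand a t X X' s

/-- `V t X` is a classical solution on `[0, ∞) × ℝ` of `∂V/∂t = M^a V`, `V(0, X) = V₀(X)`: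
it is continuous up to `t = 0`, of class `C^{1,2}` for `t > 0`, satisfies the equation at all
points with `t > 0` and takes the initial value `V₀`. (Values at `t < 0` play no role.) -/
structure IsClassicalSolution (a : ℝ) (V₀ : ℝ → ℂ) (V : ℝ → ℝ → ℂ) : Prop where
  continuousOn : ContinuousOn (fun p : ℝ × ℝ => V p.1 p.2) (Ici 0 ×ˢ univ)
  initial : ∀ X, V 0 X = V₀ X
  differentiableAt_time : ∀ t, 0 < t → ∀ X, DifferentiableAt ℝ (fun τ => V τ X) t
  contDiff_space : ∀ t, 0 < t → ContDiff ℝ 2 (V t)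
  continuousOn_time_deriv :
    ContinuousOn (fun p : ℝ × ℝ => deriv (fun τ => V τ p.2) p.1) (Ioi 0 ×ˢ univ)
  continuousOn_space_deriv :
    ContinuousOn (fun p : ℝ × ℝ => deriv (V p.1) p.2) (Ioi 0 ×ˢ univ)
  continuousOn_space_deriv_two :
    ContinuousOn (fun p : ℝ × ℝ => deriv (deriv (V p.1)) p.2) (Ioi 0 ×ˢ univ)
  equation : ∀ t, 0 < t → ∀ X, morseOperator a (V t) X = deriv (fun τ => V τ X) t

/-- The Tychonoff growth condition: on every strip `0 ≤ t ≤ T` one has `|V(t, X)| ≤ C e^{c X²}`,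
with constants that may depend on `T`. -/
def HasTychonoffGrowth (V : ℝ → ℝ → ℂ) : Prop :=
  ∀ T : ℝ, 0 < T → ∃ C c : ℝ, ∀ t ∈ Icc 0 T, ∀ X, ‖V t X‖ ≤ C * Real.exp (c * X ^ 2)

end MorseHeat

end

noncomputable section

namespace MorseHeat

open Filter Topology Function

/-! The heat problem is reduced to the wave equation `∂ₛ² P = M^a P` with `P = 0`, `∂ₛ P = V₀` at `s
= 0`. Its Riemann function is explicit: it is `R = C₀(w)`, with `w = coneArg` vanishing on the edges
`y = X ± s` of the light cone and `C₀` the entire function with `J₀(z) = C₀(z²/4)`. Hence `P` is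
half the integral of `R V₀` over the base of the cone (`riemann_wave`, `wave_equation`).

Averaging in `s` over a Gaussian of variance `2t` turns `∂ₛ²` into `∂ₜ`
(`hasDerivAt_gaussMean_time`), so the mean of `∂ₛ P` is a solution `V`; formally this is `exp(tM) =
E cos(s √(-M))`. Gaussian integration by parts rewrites it as `V = (2t)⁻¹ E[s P]`
(`heatSolution_eq`). Since `s P` is even in `s`, Fubini over the cone `|X - y| < s` identifies this
with integration against `K_a` (`integral_heatKernel_mul`).

The estimates rest on `|C_n| ≤ 1` on `[0, ∞)` (`abs_clifford_le_one`) and on `w ≥ 0` in the cone: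
the derivatives of `R` grow at most exponentially in `s`, which every Gaussian absorbs, and `|P| ≤ M
|s|` makes `V` bounded.

Uniqueness is a maximum principle for real parts of differences (`nonpos_of_growth`). The potential
has the good sign, and a Gaussian barrier handles infinity on short time intervals, which are then
chained. -/

/-! ### Bessel–Clifford functions -/

/-- The Bessel--Clifford function `∑ (-w)^k / (k! (k+n)!)`, so that `J₀(z) = C₀(z²/4)`. -/
def clifford (n : ℕ) (w : ℝ) : ℝ :=
  ∑' k : ℕ, (-w) ^ k / ((k.factorial : ℝ) * ((k + n).factorial : ℝ))

theorem norm_clifford_term_le (n k : ℕ) (w : ℝ) :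
    ‖(-w) ^ k / ((k.factorial : ℝ) * ((k + n).factorial : ℝ))‖ ≤ |w| ^ k / k.factorial := by
  have h1 : (1 : ℝ) ≤ (k + n).factorial := by exact_mod_cast (k + n).factorial_pos
  have h2 : (0 : ℝ) < k.factorial := by exact_mod_cast k.factorial_pos
  rw [norm_div, norm_pow, norm_neg, Real.norm_eq_abs, Real.norm_of_nonneg (by positivity)]
  gcongr
  nlinarith

theorem summable_clifford (n : ℕ) (w : ℝ) :
    Summable fun k : ℕ => (-w) ^ k / ((k.factorial : ℝ) * ((k + n).factorial : ℝ)) :=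
  Summable.of_norm_bounded (Real.summable_pow_div_factorial |w|) fun k =>
    norm_clifford_term_le n k w

theorem besselJ0_eq_clifford (z : ℝ) : besselJ0 z = clifford 0 (z ^ 2 / 4) := by
  unfold besselJ0 clifford
  refine tsum_congr fun k => ?_
  rw [pow_mul, ← mul_pow, add_zero, sq (k.factorial : ℝ)]
  congr 2
  ring

theorem clifford_zero_right (n : ℕ) : clifford n 0 = 1 / n.factorial := by
  unfold clifford
  rw [tsum_eq_single 0]
  · simp
  · intro k hk
    simp [hk]

theorem hasDerivAt_clifford (n : ℕ) (w : ℝ) :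
    HasDerivAt (clifford n) (-clifford (n + 1) w) w := by
  have key : HasDerivAt (clifford n)
      (∑' k : ℕ, (k : ℝ) * (-w) ^ (k - 1) * (-1) /
        ((k.factorial : ℝ) * ((k + n).factorial : ℝ))) w := by
    -- The ball contains both `w` and the base point `0`; on it the derivatives of the terms are
    -- dominated by those of the exponential series at `|w| + 1`.
    refine hasDerivAt_tsum_of_isPreconnected (t := Metric.ball 0 (|w| + 1)) (y₀ := 0)
      (u := fun k : ℕ => (k : ℝ) * (|w| + 1) ^ (k - 1) / k.factorial)
      (g := fun (k : ℕ) (y : ℝ) => (-y) ^ k / ((k.factorial : ℝ) * ((k + n).factorial : ℝ)))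
      (g' := fun (k : ℕ) (y : ℝ) => (k : ℝ) * (-y) ^ (k - 1) * (-1) /
        ((k.factorial : ℝ) * ((k + n).factorial : ℝ)))
      ?_ Metric.isOpen_ball
      (convex_ball _ _).isPreconnected ?_ ?_ ?_ (summable_clifford n 0) ?_
    · rw [← summable_nat_add_iff 1]
      refine (Real.summable_pow_div_factorial (|w| + 1)).congr fun k => ?_
      have : ((k + 1).factorial : ℝ) = (k + 1) * k.factorial := by
        exact_mod_cast Nat.factorial_succ k
      rw [this]
      push_cast
      rw [mul_div_mul_left _ _ (by positivity)]
    · intro k y _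
      have := ((hasDerivAt_id y).neg.pow k).div_const
        ((k.factorial : ℝ) * ((k + n).factorial : ℝ))
      simpa using this
    · intro k y hy
      have hy' : |y| ≤ |w| + 1 := by
        simpa using (mem_ball_zero_iff.1 hy).le
      have h1 : (1 : ℝ) ≤ (k + n).factorial := by exact_mod_cast (k + n).factorial_pos
      have h2 : (0 : ℝ) < k.factorial := by exact_mod_cast k.factorial_pos
      rw [norm_div, norm_mul, norm_mul, norm_pow, norm_neg, norm_neg, norm_one, mul_one,
        Real.norm_of_nonneg (by positivity), Real.norm_eq_abs, Real.norm_of_nonneg (by positivity)]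
      gcongr
      nlinarith
    · simp; positivity
    · simp
  convert key using 1
  rw [Summable.tsum_eq_zero_add]
  · unfold clifford
    rw [← tsum_neg]
    simp only [CharP.cast_eq_zero, zero_mul, zero_div, zero_add]
    refine tsum_congr fun k => ?_
    have : ((k + 1).factorial : ℝ) = (k + 1) * k.factorial := by
      exact_mod_cast Nat.factorial_succ k
    have h2 : (k.factorial : ℝ) ≠ 0 := by exact_mod_cast k.factorial_ne_zero
    have h3 : ((k + 1 + n).factorial : ℝ) ≠ 0 := by exact_mod_cast (k + 1 + n).factorial_ne_zero
    rw [this, Nat.add_sub_cancel, show k + (n + 1) = k + 1 + n by ring]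
    push_cast
    field_simp
  · rw [← summable_nat_add_iff 1]
    refine (summable_clifford (n + 1) w).neg.congr fun k => ?_
    have : ((k + 1).factorial : ℝ) = (k + 1) * k.factorial := by
      exact_mod_cast Nat.factorial_succ k
    have h2 : (k.factorial : ℝ) ≠ 0 := by exact_mod_cast k.factorial_ne_zero
    have h3 : ((k + 1 + n).factorial : ℝ) ≠ 0 := by exact_mod_cast (k + 1 + n).factorial_ne_zero
    rw [this, Nat.add_sub_cancel, show k + (n + 1) = k + 1 + n by ring]
    push_cast
    field_simp

theorem continuous_clifford (n : ℕ) : Continuous (clifford n) :=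
  continuous_iff_continuousAt.2 fun w => (hasDerivAt_clifford n w).continuousAt

/-- In the coefficients, `1/(k+n)! = ((n+1) + k)/(k+n+1)!`; the summand with `k` becomes `-w
C_{n+2}` after an index shift. Combined with `C_n' = -C_{n+1}` this is Bessel's equation. -/
theorem clifford_recurrence (n : ℕ) (w : ℝ) :
    clifford n w = (n + 1) * clifford (n + 1) w - w * clifford (n + 2) w := by
  have e : ∀ k : ℕ, (-w) ^ (k + 1) * ((k + 1 : ℕ) : ℝ) /
      (((k + 1).factorial : ℝ) * ((k + 1 + (n + 1)).factorial : ℝ)) =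
      -w * ((-w) ^ k / ((k.factorial : ℝ) * ((k + (n + 2)).factorial : ℝ))) := fun k => by
    have : ((k + 1).factorial : ℝ) = (k + 1) * k.factorial := by
      exact_mod_cast Nat.factorial_succ k
    have h2 : (k.factorial : ℝ) ≠ 0 := by exact_mod_cast k.factorial_ne_zero
    have h3 : ((k + 1 + (n + 1)).factorial : ℝ) ≠ 0 := by
      exact_mod_cast (k + 1 + (n + 1)).factorial_ne_zero
    rw [this, show k + (n + 2) = k + 1 + (n + 1) by ring]
    push_cast
    field_simp
    ring
  have hs : Summable fun k : ℕ => (-w) ^ k * (k : ℝ) /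
      ((k.factorial : ℝ) * ((k + (n + 1)).factorial : ℝ)) := by
    rw [← summable_nat_add_iff 1]
    exact ((summable_clifford (n + 2) w).mul_left (-w)).congr fun k => (e k).symm
  have h1 : -w * clifford (n + 2) w = ∑' k : ℕ, (-w) ^ k * (k : ℝ) /
      ((k.factorial : ℝ) * ((k + (n + 1)).factorial : ℝ)) := by
    rw [hs.tsum_eq_zero_add]
    unfold clifford
    rw [← tsum_mul_left]
    simp only [e, CharP.cast_eq_zero, mul_zero, zero_div, zero_add]
  rw [sub_eq_add_neg, ← neg_mul, h1]
  unfold clifford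
  rw [← tsum_mul_left, ← Summable.tsum_add ((summable_clifford (n + 1) w).mul_left _) hs]
  refine tsum_congr fun k => ?_
  have : ((k + (n + 1)).factorial : ℝ) = (k + n + 1) * (k + n).factorial := by
    exact_mod_cast Nat.factorial_succ (k + n)
  have h2 : (k.factorial : ℝ) ≠ 0 := by exact_mod_cast k.factorial_ne_zero
  have h3 : ((k + n).factorial : ℝ) ≠ 0 := by exact_mod_cast (k + n).factorial_ne_zero
  have h4 : (k + n + 1 : ℝ) ≠ 0 := by positivity
  rw [this]
  field_simp
  ring

/-- The energy `C_n² + x C_{n+1}²` has derivative `-(2n+1) C_{n+1}² ≤ 0` by the recurrence, so on `x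
≥ 0` it stays below its value `1/(n!)²` at `0`. -/
theorem abs_clifford_le_one (n : ℕ) {w : ℝ} (hw : 0 ≤ w) : |clifford n w| ≤ 1 := by
  have hd : ∀ x : ℝ, HasDerivAt (fun x => clifford n x ^ 2 + x * clifford (n + 1) x ^ 2)
      (-(2 * n + 1) * clifford (n + 1) x ^ 2) x := fun x => by
    have h := ((hasDerivAt_clifford n x).pow 2).add
      ((hasDerivAt_id x).mul ((hasDerivAt_clifford (n + 1) x).pow 2))
    refine h.congr_deriv ?_
    simp only [id, clifford_recurrence n x]
    norm_num
    ring
  have hanti : Antitone fun x => clifford n x ^ 2 + x * clifford (n + 1) x ^ 2 := by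
    refine antitone_of_deriv_nonpos (fun x => (hd x).differentiableAt) fun x => ?_
    rw [(hd x).deriv]
    have := sq_nonneg (clifford (n + 1) x)
    have : (0 : ℝ) ≤ n := n.cast_nonneg
    nlinarith
  have h := hanti hw
  simp only [zero_mul, add_zero, clifford_zero_right] at h
  have h1 : (1 : ℝ) ≤ n.factorial := by exact_mod_cast n.factorial_pos
  have h3 : (1 : ℝ) / n.factorial ≤ 1 := by rw [div_le_one (by positivity)]; exact h1
  have h4 : (0 : ℝ) ≤ 1 / n.factorial := by positivity
  rw [abs_le_one_iff_mul_self_le_one]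
  have h5 : 0 ≤ w * clifford (n + 1) w ^ 2 := by positivity
  nlinarith

/-! ### Differentiation of integrals with a parameter -/

theorem hasDerivAt_intervalIntegral_param {f f' : ℝ → ℝ → ℂ} (hf : Continuous (uncurry f))
    (hf' : Continuous (uncurry f')) (hd : ∀ τ y, HasDerivAt (fun σ => f σ y) (f' τ y) τ)
    (a b τ : ℝ) :
    HasDerivAt (fun σ => ∫ y in a..b, f σ y) (∫ y in a..b, f' τ y) τ := by
  have hc : IsCompact (Icc (τ - 1) (τ + 1) ×ˢ uIcc a b) := isCompact_Icc.prod isCompact_uIcc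
  obtain ⟨M, hM⟩ := hc.exists_bound_of_continuousOn hf'.continuousOn
  refine (intervalIntegral.hasDerivAt_integral_of_dominated_loc_of_deriv_le
    (s := Icc (τ - 1) (τ + 1)) (bound := fun _ => M) (F' := f')
    (Icc_mem_nhds (by linarith) (by linarith)) ?_ ?_ ?_ ?_ ?_ ?_).2
  · exact Eventually.of_forall fun σ =>
      (hf.comp (Continuous.prodMk_right σ)).aestronglyMeasurable
  · exact (hf.comp (Continuous.prodMk_right τ)).intervalIntegrable _ _
  · exact (hf'.comp (Continuous.prodMk_right τ)).aestronglyMeasurable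
  · exact Eventually.of_forall fun y hy σ hσ => hM (σ, y) ⟨hσ, uIoc_subset_uIcc hy⟩
  · exact intervalIntegrable_const
  · exact Eventually.of_forall fun y _ σ _ => hd σ y

/-- The Leibniz rule for an integral whose integrand and limits depend on a parameter. -/
theorem hasDerivAt_intervalIntegral_leibniz {f f' : ℝ → ℝ → ℂ} (hf : Continuous (uncurry f))
    (hf' : Continuous (uncurry f')) (hd : ∀ τ y, HasDerivAt (fun σ => f σ y) (f' τ y) τ)
    {α β : ℝ → ℝ} {α' β' τ : ℝ} (hα : HasDerivAt α α' τ) (hβ : HasDerivAt β β' τ) :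
    HasDerivAt (fun σ => ∫ y in α σ..β σ, f σ y)
      ((∫ y in α τ..β τ, f' τ y) + (β' • f τ (β τ) - α' • f τ (α τ))) τ := by
  -- The parameter of the integrand and the upper limit are treated as independent variables. Both
  -- partial derivatives are jointly continuous, so the function of two variables is strictly
  -- differentiable and the chain rule applies along `σ ↦ (σ, γ σ)`.
  have key : ∀ b : ℝ, HasStrictFDerivAt (uncurry fun σ b => ∫ y in (0 : ℝ)..b, f σ y)
      ((ContinuousLinearMap.toSpanSingleton ℝ (∫ y in (0 : ℝ)..b, f' τ y)).coprod
        (ContinuousLinearMap.toSpanSingleton ℝ (f τ b))) (τ, b) := fun b => by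
    refine hasStrictFDerivAt_uncurry_coprod (u := (τ, b))
      (f := fun σ b => ∫ y in (0 : ℝ)..b, f σ y)
      (f₁ := fun σ b => ContinuousLinearMap.toSpanSingleton ℝ (∫ y in (0 : ℝ)..b, f' σ y))
      (f₂ := fun σ b => ContinuousLinearMap.toSpanSingleton ℝ (f σ b)) ?_ ?_ ?_ ?_
    · exact Eventually.of_forall fun v =>
        (hasDerivAt_intervalIntegral_param hf hf' hd 0 v.2 v.1).hasFDerivAt
    · refine Eventually.of_forall fun v => HasDerivAt.hasFDerivAt ?_
      have hc : Continuous (f v.1) := hf.comp (Continuous.prodMk_right v.1)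
      exact intervalIntegral.integral_hasDerivAt_right (hc.intervalIntegrable _ _)
        hc.stronglyMeasurable.stronglyMeasurableAtFilter hc.continuousAt
    · exact ((ContinuousLinearMap.toSpanSingletonCLE (𝕜 := ℝ) (E := ℂ)).continuous.comp
        (intervalIntegral.continuous_parametric_primitive_of_continuous (a₀ := 0) hf')).continuousAt
    · exact ((ContinuousLinearMap.toSpanSingletonCLE (𝕜 := ℝ) (E := ℂ)).continuous.comp
        hf).continuousAt
  have side : ∀ {γ : ℝ → ℝ} {γ' : ℝ}, HasDerivAt γ γ' τ →
      HasDerivAt (fun σ => ∫ y in (0 : ℝ)..γ σ, f σ y)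
        ((∫ y in (0 : ℝ)..γ τ, f' τ y) + γ' • f τ (γ τ)) τ := fun {γ γ'} hγ => by
    have h := (key (γ τ)).hasFDerivAt.comp_hasDerivAt τ ((hasDerivAt_id τ).prodMk hγ)
    refine HasDerivAt.congr_deriv (f := fun σ => ∫ y in (0 : ℝ)..γ σ, f σ y) h ?_
    simp
  have hi : ∀ {g : ℝ → ℝ → ℂ}, Continuous (uncurry g) → ∀ σ a b,
      IntervalIntegrable (g σ) volume a b := fun hg σ a b =>
    (hg.comp (Continuous.prodMk_right σ)).intervalIntegrable _ _
  have h := (side hβ).sub (side hα)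
  have e : ∀ σ, (∫ y in α σ..β σ, f σ y) =
      (∫ y in (0 : ℝ)..β σ, f σ y) - ∫ y in (0 : ℝ)..α σ, f σ y := fun σ =>
    (intervalIntegral.integral_interval_sub_left (hi hf σ _ _) (hi hf σ _ _)).symm
  have e' : (∫ y in α τ..β τ, f' τ y) =
      (∫ y in (0 : ℝ)..β τ, f' τ y) - ∫ y in (0 : ℝ)..α τ, f' τ y :=
    (intervalIntegral.integral_interval_sub_left (hi hf' τ _ _) (hi hf' τ _ _)).symm
  rw [funext e, e']
  refine h.congr_deriv ?_
  abel

/-! ### Growth slower than every Gaussian -/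

/-- Completing the square: exponential growth at any rate `c` is absorbed by an arbitrarily weak
Gaussian `exp(b s²)`. -/
theorem mul_abs_le_add_mul_sq (c s : ℝ) {b : ℝ} (hb : 0 < b) :
    c * |s| ≤ c ^ 2 / (4 * b) + b * s ^ 2 := by
  have h : c ^ 2 / (4 * b) + b * s ^ 2 - c * |s| = b * (|s| - c / (2 * b)) ^ 2 := by
    rw [← sq_abs s]
    field_simp
    ring
  have : 0 ≤ b * (|s| - c / (2 * b)) ^ 2 := by positivity
  linarith

theorem abs_sub_le_of_mem_uIoc {s X y : ℝ} (hy : y ∈ uIoc (X - s) (X + s)) : |y - X| ≤ |s| := by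
  have hy' := uIoc_subset_uIcc hy
  rcases le_total 0 s with hs | hs
  · rw [uIcc_of_le (by linarith)] at hy'
    rw [abs_of_nonneg hs, abs_le]
    constructor <;> linarith [hy'.1, hy'.2]
  · rw [uIcc_of_ge (by linarith)] at hy'
    rw [abs_of_nonpos hs, abs_le]
    constructor <;> linarith [hy'.1, hy'.2]

section Growth

variable {E : Type*} [NormedAddCommGroup E]

/-- Continuous functions of `(s, X)` that grow in `s` more slowly than every Gaussian,
locally uniformly in `X`. -/
structure Subgaussian (Q : ℝ → ℝ → E) : Prop where
  cont : Continuous (uncurry Q)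
  bound : ∀ R b : ℝ, 0 < b → ∃ C, 0 ≤ C ∧ ∀ s X, |X| ≤ R → ‖Q s X‖ ≤ C * Real.exp (b * s ^ 2)

/-- Continuous functions of `(s, X, y)` that grow in `s` more slowly than every Gaussian
on the cone `|y - X| ≤ |s|`, locally uniformly in `X`. -/
structure ConeSubgaussian (f : ℝ → ℝ → ℝ → E) : Prop where
  cont : Continuous fun p : ℝ × ℝ × ℝ => f p.1 p.2.1 p.2.2
  bound : ∀ R b : ℝ, 0 < b → ∃ C, 0 ≤ C ∧ ∀ s X y, |X| ≤ R → |y - X| ≤ |s| →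
    ‖f s X y‖ ≤ C * Real.exp (b * s ^ 2)

theorem Subgaussian.add {P Q : ℝ → ℝ → E} (hP : Subgaussian P) (hQ : Subgaussian Q) :
    Subgaussian fun s X => P s X + Q s X where
  cont := hP.cont.add hQ.cont
  bound R b hb := by
    obtain ⟨C, hC, h⟩ := hP.bound R b hb
    obtain ⟨D, hD, h'⟩ := hQ.bound R b hb
    refine ⟨C + D, add_nonneg hC hD, fun s X hX => ?_⟩
    rw [add_mul]
    exact (norm_add_le _ _).trans (add_le_add (h s X hX) (h' s X hX))

theorem Subgaussian.smul [NormedSpace ℝ E] {P : ℝ → ℝ → ℝ} {Q : ℝ → ℝ → E} (hP : Subgaussian P)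
    (hQ : Subgaussian Q) : Subgaussian fun s X => P s X • Q s X where
  cont := hP.cont.smul hQ.cont
  bound R b hb := by
    obtain ⟨C, hC, h⟩ := hP.bound R (b / 2) (half_pos hb)
    obtain ⟨D, hD, h'⟩ := hQ.bound R (b / 2) (half_pos hb)
    refine ⟨C * D, mul_nonneg hC hD, fun s X hX => ?_⟩
    rw [norm_smul, show b * s ^ 2 = b / 2 * s ^ 2 + b / 2 * s ^ 2 by ring, Real.exp_add,
      mul_mul_mul_comm]
    exact mul_le_mul (h s X hX) (h' s X hX) (norm_nonneg _) (by positivity)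

theorem Subgaussian.const_smul [NormedSpace ℝ E] {Q : ℝ → ℝ → E} (hQ : Subgaussian Q) (c : ℝ) :
    Subgaussian fun s X => c • Q s X where
  cont := hQ.cont.const_smul c
  bound R b hb := by
    obtain ⟨D, hD, h'⟩ := hQ.bound R b hb
    refine ⟨|c| * D, by positivity, fun s X hX => ?_⟩
    rw [norm_smul, mul_assoc]
    exact mul_le_mul_of_nonneg_left (h' s X hX) (norm_nonneg _)

theorem subgaussian_fst : Subgaussian fun s _ : ℝ => s where
  cont := continuous_fst
  bound R b hb := by
    refine ⟨Real.exp (1 ^ 2 / (4 * b)), by positivity, fun s X _ => ?_⟩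
    rw [← Real.exp_add, Real.norm_eq_abs]
    have := mul_abs_le_add_mul_sq 1 s hb
    linarith [Real.add_one_le_exp (1 ^ 2 / (4 * b) + b * s ^ 2)]

theorem ConeSubgaussian.of_exp_bound {f : ℝ → ℝ → ℝ → E}
    (hf : Continuous fun p : ℝ × ℝ × ℝ => f p.1 p.2.1 p.2.2)
    (h : ∀ R : ℝ, ∃ C c, 0 ≤ C ∧ ∀ s X y, |X| ≤ R → |y - X| ≤ |s| →
      ‖f s X y‖ ≤ C * Real.exp (c * |s|)) : ConeSubgaussian f where
  cont := hf
  bound R b hb := by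
    obtain ⟨C, c, hC, hc⟩ := h R
    refine ⟨C * Real.exp (c ^ 2 / (4 * b)), by positivity, fun s X y hX hy => ?_⟩
    rw [mul_assoc, ← Real.exp_add]
    refine (hc s X y hX hy).trans ?_
    gcongr
    exact mul_abs_le_add_mul_sq c s hb

theorem ConeSubgaussian.add {f g : ℝ → ℝ → ℝ → E} (hf : ConeSubgaussian f)
    (hg : ConeSubgaussian g) : ConeSubgaussian fun s X y => f s X y + g s X y where
  cont := hf.cont.add hg.cont
  bound R b hb := by
    obtain ⟨C, hC, h⟩ := hf.bound R b hb
    obtain ⟨D, hD, h'⟩ := hg.bound R b hb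
    refine ⟨C + D, add_nonneg hC hD, fun s X y hX hy => ?_⟩
    rw [add_mul]
    exact (norm_add_le _ _).trans (add_le_add (h s X y hX hy) (h' s X y hX hy))

theorem Subgaussian.neg {P : ℝ → ℝ → E} (hP : Subgaussian P) : Subgaussian fun s X => -P s X where
  cont := hP.cont.neg
  bound R b hb := by simpa only [norm_neg] using hP.bound R b hb

theorem Subgaussian.sub {P Q : ℝ → ℝ → E} (hP : Subgaussian P) (hQ : Subgaussian Q) :
    Subgaussian fun s X => P s X - Q s X := by
  simpa only [sub_eq_add_neg] using hP.add hQ.neg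

theorem ConeSubgaussian.neg {f : ℝ → ℝ → ℝ → E} (hf : ConeSubgaussian f) :
    ConeSubgaussian fun s X y => -f s X y where
  cont := hf.cont.neg
  bound R b hb := by simpa only [norm_neg] using hf.bound R b hb

theorem ConeSubgaussian.sub {f g : ℝ → ℝ → ℝ → E} (hf : ConeSubgaussian f)
    (hg : ConeSubgaussian g) : ConeSubgaussian fun s X y => f s X y - g s X y := by
  simpa only [sub_eq_add_neg] using hf.add hg.neg

theorem ConeSubgaussian.smul [NormedSpace ℝ E] {f : ℝ → ℝ → ℝ → ℝ} {g : ℝ → ℝ → ℝ → E}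
    (hf : ConeSubgaussian f) (hg : ConeSubgaussian g) : ConeSubgaussian fun s X y => f s X y • g s X y where
  cont := hf.cont.smul hg.cont
  bound R b hb := by
    obtain ⟨C, hC, h⟩ := hf.bound R (b / 2) (half_pos hb)
    obtain ⟨D, hD, h'⟩ := hg.bound R (b / 2) (half_pos hb)
    refine ⟨C * D, mul_nonneg hC hD, fun s X y hX hy => ?_⟩
    rw [norm_smul, show b * s ^ 2 = b / 2 * s ^ 2 + b / 2 * s ^ 2 by ring, Real.exp_add,
      mul_mul_mul_comm]
    exact mul_le_mul (h s X y hX hy) (h' s X y hX hy) (norm_nonneg _) (by positivity)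

/-- With `ε = ±1` this controls the boundary terms that the Leibniz rule leaves on the edges of the
cone. -/
theorem ConeSubgaussian.comp_endpoint {f : ℝ → ℝ → ℝ → E} (hf : ConeSubgaussian f) {ε : ℝ}
    (hε : |ε| ≤ 1) : Subgaussian fun s X => f s X (X + ε * s) where
  cont := hf.cont.comp (by fun_prop :
    Continuous fun p : ℝ × ℝ => ((p.1, p.2, p.2 + ε * p.1) : ℝ × ℝ × ℝ))
  bound R b hb := by
    obtain ⟨C, hC, h⟩ := hf.bound R b hb
    refine ⟨C, hC, fun s X hX => h s X _ hX ?_⟩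
    rw [add_sub_cancel_left, abs_mul]
    exact mul_le_of_le_one_left (abs_nonneg s) hε

/-- Half of the allowance `b` pays for the integrand, the other half for the length `2|s|` of the
interval. -/
theorem ConeSubgaussian.intervalIntegral [NormedSpace ℝ E] {f : ℝ → ℝ → ℝ → E}
    (hf : ConeSubgaussian f) : Subgaussian fun s X => ∫ y in (X - s)..(X + s), f s X y where
  cont := by
    have hc : Continuous (uncurry fun (p : ℝ × ℝ) (y : ℝ) => f p.1 p.2 y) :=
      hf.cont.comp (by fun_prop :
        Continuous fun p : (ℝ × ℝ) × ℝ => ((p.1.1, p.1.2, p.2) : ℝ × ℝ × ℝ))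
    have h1 := intervalIntegral.continuous_parametric_intervalIntegral_of_continuous
      (a₀ := 0) (μ := volume) hc (continuous_snd.add continuous_fst)
    have h2 := intervalIntegral.continuous_parametric_intervalIntegral_of_continuous
      (a₀ := 0) (μ := volume) hc (continuous_snd.sub continuous_fst)
    refine (h1.sub h2).congr fun p => ?_
    have hi : ∀ a b, IntervalIntegrable (f p.1 p.2) volume a b := fun a b =>
      (hc.comp (Continuous.prodMk_right p)).intervalIntegrable a b
    exact intervalIntegral.integral_interval_sub_left (hi _ _) (hi _ _)
  bound R b hb := by
    obtain ⟨C, hC, h⟩ := hf.bound R (b / 2) (half_pos hb)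
    obtain ⟨D, hD, h'⟩ := (subgaussian_fst.const_smul 2).bound R (b / 2) (half_pos hb)
    refine ⟨C * D, mul_nonneg hC hD, fun s X hX => ?_⟩
    have key : ‖∫ y in (X - s)..(X + s), f s X y‖ ≤
        C * Real.exp (b / 2 * s ^ 2) * |X + s - (X - s)| := by
      refine intervalIntegral.norm_integral_le_of_norm_le_const fun y hy =>
        h s X y hX (abs_sub_le_of_mem_uIoc hy)
    refine key.trans ?_
    rw [show b * s ^ 2 = b / 2 * s ^ 2 + b / 2 * s ^ 2 by ring, Real.exp_add, mul_mul_mul_comm]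
    refine mul_le_mul_of_nonneg_left ?_ (by positivity)
    have := h' s X hX
    rwa [smul_eq_mul, Real.norm_eq_abs, show 2 * s = X + s - (X - s) by ring] at this

end Growth

/-! ### Gaussian means and the heat equation -/

/-- The mean of `Q(·, X)` over a centred Gaussian of variance `2t`. -/
def gaussMean (Q : ℝ → ℝ → ℂ) (t X : ℝ) : ℂ :=
  (Real.sqrt (2 * Real.pi))⁻¹ • ∫ z : ℝ, Real.exp (-z ^ 2 / 2) • Q (Real.sqrt (2 * t) * z) X

/-- After the scaling `s = √(2t) z` the weight no longer depends on `t`, so one integrable bound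
serves all scales `|r| ≤ r₀`, including `r = 0`. -/
theorem Subgaussian.exists_dominating {Q : ℝ → ℝ → ℂ} (hQ : Subgaussian Q) (R r₀ : ℝ) :
    ∃ C, 0 ≤ C ∧ ∀ r X z, |r| ≤ r₀ → |X| ≤ R →
      ‖Real.exp (-z ^ 2 / 2) • Q (r * z) X‖ ≤ C * Real.exp (-(1 / 4) * z ^ 2) := by
  -- This rate costs at most `z²/4` of the exponent `z²/2`; the `+ 1` covers `r₀ = 0`.
  have hb : 0 < 1 / (4 * (r₀ ^ 2 + 1)) := by positivity
  obtain ⟨C, hC, h⟩ := hQ.bound R _ hb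
  refine ⟨C, hC, fun r X z hr hX => ?_⟩
  rw [norm_smul, Real.norm_of_nonneg (Real.exp_pos _).le]
  calc Real.exp (-z ^ 2 / 2) * ‖Q (r * z) X‖
      ≤ Real.exp (-z ^ 2 / 2) * (C * Real.exp (1 / (4 * (r₀ ^ 2 + 1)) * (r * z) ^ 2)) := by
        gcongr
        exact h _ X hX
    _ = C * Real.exp (-z ^ 2 / 2 + 1 / (4 * (r₀ ^ 2 + 1)) * (r * z) ^ 2) := by
        rw [Real.exp_add]; ring
    _ ≤ C * Real.exp (-(1 / 4) * z ^ 2) := by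
        gcongr
        have h1 : r ^ 2 ≤ r₀ ^ 2 :=
          sq_le_sq' (by linarith [neg_abs_le r]) (by linarith [le_abs_self r])
        have h2 : 1 / (4 * (r₀ ^ 2 + 1)) * (r * z) ^ 2 ≤ 1 / 4 * z ^ 2 := by
          rw [mul_pow, ← mul_assoc]
          gcongr
          rw [one_div_mul_eq_div, div_le_iff₀ (by positivity)]
          linarith
        linarith

theorem integrable_exp_neg_quarter : Integrable fun z : ℝ => Real.exp (-(1 / 4) * z ^ 2) :=
  integrable_exp_neg_mul_sq (by norm_num)

theorem Subgaussian.continuous_gauss {Q : ℝ → ℝ → ℂ} (hQ : Subgaussian Q) (r X : ℝ) :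
    Continuous fun z : ℝ => Real.exp (-z ^ 2 / 2) • Q (r * z) X := by
  have : Continuous fun z : ℝ => Q (r * z) X :=
    hQ.cont.comp (by fun_prop : Continuous fun z : ℝ => ((r * z, X) : ℝ × ℝ))
  exact (by fun_prop : Continuous fun z : ℝ => Real.exp (-z ^ 2 / 2)).smul this

theorem Subgaussian.integrable_gauss {Q : ℝ → ℝ → ℂ} (hQ : Subgaussian Q) (r X : ℝ) :
    Integrable fun z : ℝ => Real.exp (-z ^ 2 / 2) • Q (r * z) X := by
  obtain ⟨C, _, h⟩ := hQ.exists_dominating |X| |r|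
  exact (integrable_exp_neg_quarter.const_mul C).mono'
    (hQ.continuous_gauss r X).aestronglyMeasurable
    (Eventually.of_forall fun z => h r X z le_rfl le_rfl)

/-- Continuity holds up to and across `t = 0`, because `Real.sqrt` is continuous with value `0` on
negative numbers. This gives the continuity of the solution at the initial time. -/
theorem Subgaussian.continuous_gaussMean {Q : ℝ → ℝ → ℂ} (hQ : Subgaussian Q) :
    Continuous (uncurry (gaussMean Q)) := by
  refine continuous_iff_continuousAt.2 fun ⟨t, X⟩ => ?_
  refine ContinuousAt.const_smul (c := (Real.sqrt (2 * Real.pi))⁻¹) ?_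
  obtain ⟨C, _, h⟩ := hQ.exists_dominating (|X| + 1) (Real.sqrt (2 * (t + 1)))
  refine continuousAt_of_dominated (F := fun (p : ℝ × ℝ) (z : ℝ) =>
    Real.exp (-z ^ 2 / 2) • Q (Real.sqrt (2 * p.1) * z) p.2)
    (bound := fun z => C * Real.exp (-(1 / 4) * z ^ 2)) ?_ ?_ ?_ ?_
  · exact Eventually.of_forall fun p => (hQ.continuous_gauss _ _).aestronglyMeasurable
  · have h1 : ∀ᶠ p : ℝ × ℝ in 𝓝 (t, X), p.1 < t + 1 :=
      continuous_fst.continuousAt.eventually_lt continuousAt_const (by simp)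
    have h2 : ∀ᶠ p : ℝ × ℝ in 𝓝 (t, X), |p.2| < |X| + 1 :=
      continuous_snd.abs.continuousAt.eventually_lt continuousAt_const (by simp)
    filter_upwards [h1, h2] with p hp1 hp2
    refine Eventually.of_forall fun z => h _ _ z ?_ hp2.le
    rw [abs_of_nonneg (Real.sqrt_nonneg _)]
    exact Real.sqrt_le_sqrt (by linarith)
  · exact integrable_exp_neg_quarter.const_mul C
  · refine Eventually.of_forall fun z => ?_
    have : Continuous fun p : ℝ × ℝ => uncurry Q (Real.sqrt (2 * p.1) * z, p.2) :=
      hQ.cont.comp (by fun_prop)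
    exact (this.const_smul (Real.exp (-z ^ 2 / 2))).continuousAt

theorem gaussMean_add {P Q : ℝ → ℝ → ℂ} (hP : Subgaussian P) (hQ : Subgaussian Q) (t X : ℝ) :
    gaussMean (fun s X => P s X + Q s X) t X = gaussMean P t X + gaussMean Q t X := by
  unfold gaussMean
  rw [← smul_add, ← integral_add (hP.integrable_gauss _ X) (hQ.integrable_gauss _ X)]
  simp only [smul_add]

theorem gaussMean_const_smul (Q : ℝ → ℝ → ℂ) (c : ℝ → ℝ) (t X : ℝ) :
    gaussMean (fun s X => c X • Q s X) t X = c X • gaussMean Q t X := by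
  unfold gaussMean
  rw [smul_comm (c X), ← integral_smul (c X)]
  simp only [smul_comm (c X)]

theorem gaussMean_zero_left (Q : ℝ → ℝ → ℂ) (X : ℝ) : gaussMean Q 0 X = Q 0 X := by
  unfold gaussMean
  simp only [mul_zero, Real.sqrt_zero, zero_mul]
  rw [integral_smul_const]
  have h := integral_gaussian (1 / 2)
  have e : (fun z : ℝ => Real.exp (-z ^ 2 / 2)) = fun z => Real.exp (-(1 / 2) * z ^ 2) := by
    ext z; congr 1; ring
  rw [e, h, smul_smul, show Real.pi / (1 / 2) = 2 * Real.pi by ring, inv_mul_cancel₀, one_smul]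
  positivity

theorem hasDerivAt_gaussMean_space {Q Q' : ℝ → ℝ → ℂ} (hQ : Subgaussian Q) (hQ' : Subgaussian Q')
    (hd : ∀ s X, HasDerivAt (Q s) (Q' s X) X) (t X : ℝ) :
    HasDerivAt (gaussMean Q t) (gaussMean Q' t X) X := by
  obtain ⟨C, _, h⟩ := hQ'.exists_dominating (|X| + 1) (Real.sqrt (2 * t))
  refine HasDerivAt.const_smul (Real.sqrt (2 * Real.pi))⁻¹
    (hasDerivAt_integral_of_dominated_loc_of_deriv_le
      (F := fun (x : ℝ) (z : ℝ) => Real.exp (-z ^ 2 / 2) • Q (Real.sqrt (2 * t) * z) x)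
      (F' := fun (x : ℝ) (z : ℝ) => Real.exp (-z ^ 2 / 2) • Q' (Real.sqrt (2 * t) * z) x)
      (bound := fun z => C * Real.exp (-(1 / 4) * z ^ 2))
      (Metric.ball_mem_nhds X one_pos) ?_ ?_ ?_ ?_ ?_ ?_).2
  · exact Eventually.of_forall fun x => (hQ.continuous_gauss _ _).aestronglyMeasurable
  · exact hQ.integrable_gauss _ _
  · exact (hQ'.continuous_gauss _ _).aestronglyMeasurable
  · refine Eventually.of_forall fun z x hx => h _ _ z ?_ ?_
    · rw [abs_of_nonneg (Real.sqrt_nonneg _)]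
    · rw [Metric.mem_ball, Real.dist_eq] at hx
      linarith [abs_sub_abs_le_abs_sub x X]
  · exact integrable_exp_neg_quarter.const_mul C
  · exact Eventually.of_forall fun z x _ => (hd _ x).fun_const_smul _

/-- Gaussian integration by parts. -/
theorem gaussMean_fst_smul {Q Q' : ℝ → ℝ → ℂ} (hQ : Subgaussian Q) (hQ' : Subgaussian Q')
    (hd : ∀ s X, HasDerivAt (fun σ => Q σ X) (Q' s X) s) {t : ℝ} (ht : 0 ≤ t) (X : ℝ) :
    gaussMean (fun s X => s • Q s X) t X = (2 * t) • gaussMean Q' t X := by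
  set r := Real.sqrt (2 * t) with hr
  have hr2 : r * r = 2 * t := Real.mul_self_sqrt (by positivity)
  have hsQ : Subgaussian fun s X => s • Q s X := subgaussian_fst.smul hQ
  -- With `r² = 2t` the two terms of this derivative are the integrands of the two sides, and the
  -- integral of an integrable derivative of an integrable function over the line vanishes.
  have hderiv : ∀ z : ℝ, HasDerivAt (fun z => r • (Real.exp (-z ^ 2 / 2) • Q (r * z) X))
      ((r * r) • (Real.exp (-z ^ 2 / 2) • Q' (r * z) X) -
        Real.exp (-z ^ 2 / 2) • ((r * z) • Q (r * z) X)) z := fun z => by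
    have h1 : HasDerivAt (fun z : ℝ => Real.exp (-z ^ 2 / 2)) (Real.exp (-z ^ 2 / 2) * -z) z := by
      refine (((hasDerivAt_pow 2 z).fun_neg.div_const 2).exp).congr_deriv ?_
      norm_num
      ring
    have h2 : HasDerivAt (fun z : ℝ => Q (r * z) X) (r • Q' (r * z) X) z := by
      have h3 : HasDerivAt (fun z : ℝ => r * z) r z := by
        simpa using (hasDerivAt_id z).const_mul r
      exact HasDerivAt.scomp z (hd (r * z) X) h3
    refine ((h1.smul h2).const_smul r).congr_deriv ?_
    simp only [Complex.real_smul]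
    push_cast
    ring
  have hi := ((hQ'.integrable_gauss r X).fun_smul (r * r)).sub (hsQ.integrable_gauss r X)
  have h := integral_eq_zero_of_hasDerivAt_of_integrable hderiv hi
    ((hQ.integrable_gauss r X).smul r)
  rw [integral_sub ((hQ'.integrable_gauss r X).fun_smul (r * r)) (hsQ.integrable_gauss r X),
    integral_smul, sub_eq_zero] at h
  unfold gaussMean
  rw [← hr, ← h, smul_comm, hr2]

/-- Since `∂ₜ(√(2t) z) = √(2t) z / (2t)`, differentiation gives `(2t)⁻¹` times the mean of `s Q'`;
integration by parts turns this into the mean of `Q''`. -/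
theorem hasDerivAt_gaussMean_time {Q Q' Q'' : ℝ → ℝ → ℂ} (hQ : Subgaussian Q)
    (hQ' : Subgaussian Q') (hQ'' : Subgaussian Q'')
    (hd : ∀ s X, HasDerivAt (fun σ => Q σ X) (Q' s X) s)
    (hd' : ∀ s X, HasDerivAt (fun σ => Q' σ X) (Q'' s X) s) {t : ℝ} (ht : 0 < t) (X : ℝ) :
    HasDerivAt (fun τ => gaussMean Q τ X) (gaussMean Q'' t X) t := by
  have hsQ : Subgaussian fun s X => s • Q' s X := subgaussian_fst.smul hQ'
  obtain ⟨C, hC, h⟩ := hsQ.exists_dominating |X| (Real.sqrt (2 * (2 * t)))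
  have key := (hasDerivAt_integral_of_dominated_loc_of_deriv_le
      (F := fun (τ : ℝ) (z : ℝ) => Real.exp (-z ^ 2 / 2) • Q (Real.sqrt (2 * τ) * z) X)
      (F' := fun (τ : ℝ) (z : ℝ) => (2 * τ)⁻¹ • (Real.exp (-z ^ 2 / 2) •
        ((Real.sqrt (2 * τ) * z) • Q' (Real.sqrt (2 * τ) * z) X)))
      (bound := fun z => t⁻¹ * (C * Real.exp (-(1 / 4) * z ^ 2))) (s := Icc (t / 2) (2 * t))
      (x₀ := t) (μ := volume)
      (Icc_mem_nhds (by linarith) (by linarith)) ?_ ?_ ?_ ?_ ?_ ?_).2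
  · have h2 := key.const_smul (Real.sqrt (2 * Real.pi))⁻¹
    refine h2.congr_deriv ?_
    have h3 := gaussMean_fst_smul hQ' hQ'' hd' ht.le X
    rw [integral_smul, smul_comm]
    change (2 * t)⁻¹ • gaussMean (fun s X => s • Q' s X) t X = _
    rw [h3, smul_smul, inv_mul_cancel₀ (by positivity), one_smul]
  · exact Eventually.of_forall fun x => (hQ.continuous_gauss _ _).aestronglyMeasurable
  · exact hQ.integrable_gauss _ _
  · exact ((hsQ.continuous_gauss _ _).const_smul (2 * t)⁻¹).aestronglyMeasurable
  · refine Eventually.of_forall fun z τ hτ => ?_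
    rw [norm_smul, norm_inv, Real.norm_of_nonneg (by linarith [hτ.1])]
    have h1 : (2 * τ)⁻¹ ≤ t⁻¹ := inv_anti₀ ht (by linarith [hτ.1])
    refine mul_le_mul h1 (h _ X z ?_ le_rfl) (norm_nonneg _) (by positivity)
    rw [abs_of_nonneg (Real.sqrt_nonneg _)]
    exact Real.sqrt_le_sqrt (by linarith [hτ.2])
  · exact (integrable_exp_neg_quarter.const_mul C).const_mul _
  · refine Eventually.of_forall fun z τ hτ => ?_
    have hτ0 : 0 < 2 * τ := by linarith [hτ.1]
    have h1 : HasDerivAt (fun τ : ℝ => Real.sqrt (2 * τ) * z)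
        (2 / (2 * Real.sqrt (2 * τ)) * z) τ := by
      have h0 : HasDerivAt (fun τ : ℝ => 2 * τ) 2 τ := by
        simpa using (hasDerivAt_id τ).const_mul 2
      exact (h0.sqrt hτ0.ne').mul_const z
    have h2 := (HasDerivAt.scomp τ (hd (Real.sqrt (2 * τ) * z) X) h1).const_smul
      (Real.exp (-z ^ 2 / 2))
    refine h2.congr_deriv ?_
    rw [smul_comm (2 * τ)⁻¹, smul_smul (2 * τ)⁻¹]
    congr 2
    have hs : Real.sqrt (2 * τ) ≠ 0 := by positivity
    have hs2 : Real.sqrt (2 * τ) * Real.sqrt (2 * τ) = 2 * τ := Real.mul_self_sqrt hτ0.le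
    generalize Real.sqrt (2 * τ) = q at hs hs2 ⊢
    rw [← hs2]
    field_simp

theorem neg_sqrt_mul_sq_div {t : ℝ} (ht : 0 < t) (z : ℝ) :
    -(Real.sqrt (2 * t) * z) ^ 2 / (4 * t) = -z ^ 2 / 2 := by
  rw [mul_pow, Real.sq_sqrt (by positivity)]
  field_simp
  ring

theorem Subgaussian.integrable_heat {Q : ℝ → ℝ → ℂ} (hQ : Subgaussian Q) {t : ℝ} (ht : 0 < t)
    (X : ℝ) : Integrable fun s : ℝ => Real.exp (-s ^ 2 / (4 * t)) • Q s X := by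
  have hr : Real.sqrt (2 * t) ≠ 0 := by positivity
  rw [← integrable_comp_mul_left_iff _ hr]
  simp only [neg_sqrt_mul_sq_div ht]
  exact hQ.integrable_gauss _ X

theorem gaussMean_eq_integral (Q : ℝ → ℝ → ℂ) {t : ℝ} (ht : 0 < t) (X : ℝ) :
    gaussMean Q t X =
      (2 * Real.sqrt (Real.pi * t))⁻¹ • ∫ s : ℝ, Real.exp (-s ^ 2 / (4 * t)) • Q s X := by
  have hr : 0 < Real.sqrt (2 * t) := by positivity
  have h := Measure.integral_comp_mul_left
    (fun s : ℝ => Real.exp (-s ^ 2 / (4 * t)) • Q s X) (Real.sqrt (2 * t))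
  simp only [neg_sqrt_mul_sq_div ht] at h
  unfold gaussMean
  rw [h, smul_smul, abs_of_pos (by positivity), ← mul_inv, ← Real.sqrt_mul (by positivity)]
  congr 2
  rw [show 2 * Real.pi * (2 * t) = 2 ^ 2 * (Real.pi * t) by ring, Real.sqrt_mul (by positivity),
    Real.sqrt_sq (by positivity)]

/-- The factor `2t` is kept explicit because it cancels the prefactor `(2t)⁻¹` of the solution. -/
theorem norm_gaussMean_le_of_norm_le_sq {Q : ℝ → ℝ → ℂ} {X M : ℝ}
    (h : ∀ s, ‖Q s X‖ ≤ M * s ^ 2) {t : ℝ} (ht : 0 ≤ t) :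
    ‖gaussMean Q t X‖ ≤
      2 * t * (M * ((Real.sqrt (2 * Real.pi))⁻¹ * ∫ z : ℝ, Real.exp (-z ^ 2 / 2) * z ^ 2)) := by
  have hi : Integrable fun z : ℝ => Real.exp (-z ^ 2 / 2) * z ^ 2 := by
    have := integrable_rpow_mul_exp_neg_mul_sq (b := 1 / 2) (by norm_num) (s := 2) (by norm_num)
    refine this.congr (Eventually.of_forall fun z => ?_)
    simp only [Real.rpow_two]
    rw [mul_comm]
    congr 2
    ring
  unfold gaussMean
  rw [norm_smul, norm_inv, Real.norm_of_nonneg (Real.sqrt_nonneg _)]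
  have h1 : ‖∫ z : ℝ, Real.exp (-z ^ 2 / 2) • Q (Real.sqrt (2 * t) * z) X‖ ≤
      ∫ z : ℝ, 2 * t * M * (Real.exp (-z ^ 2 / 2) * z ^ 2) := by
    refine norm_integral_le_of_norm_le (hi.const_mul _) (Eventually.of_forall fun z => ?_)
    rw [norm_smul, Real.norm_of_nonneg (Real.exp_pos _).le]
    have := h (Real.sqrt (2 * t) * z)
    rw [mul_pow, Real.sq_sqrt (by positivity)] at this
    calc _ ≤ Real.exp (-z ^ 2 / 2) * (M * (2 * t * z ^ 2)) := by gcongr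
      _ = _ := by ring
  rw [integral_const_mul] at h1
  calc _ ≤ (Real.sqrt (2 * Real.pi))⁻¹ * (2 * t * M * ∫ z : ℝ, Real.exp (-z ^ 2 / 2) * z ^ 2) := by
        gcongr
    _ = _ := by ring

/-! ### The wave equation `∂ₛ² P = M^a P` -/

/-- The argument `w = (a²/2) e^{X+y} (cosh s - cosh (X - y))` of the Riemann function. -/
def coneArg (a s X y : ℝ) : ℝ :=
  a ^ 2 / 2 * Real.exp (X + y) * Real.cosh s -
    a ^ 2 / 4 * (Real.exp (2 * X) + Real.exp (2 * y))

/-- The expanded definition is easy to differentiate; this factored form shows the sign inside the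
cone and the vanishing on its edges. -/
theorem coneArg_eq (a s X y : ℝ) :
    coneArg a s X y = a ^ 2 / 2 * Real.exp (X + y) * (Real.cosh s - Real.cosh (X - y)) := by
  unfold coneArg
  rw [Real.cosh_eq (X - y), two_mul, two_mul, neg_sub, Real.exp_sub, Real.exp_sub, Real.exp_add,
    Real.exp_add, Real.exp_add]
  field_simp
  ring

theorem coneArg_nonneg (a : ℝ) {s X y : ℝ} (h : |y - X| ≤ |s|) : 0 ≤ coneArg a s X y := by
  rw [coneArg_eq]
  have : Real.cosh (X - y) ≤ Real.cosh s := by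
    rw [Real.cosh_le_cosh, abs_sub_comm]
    exact h
  exact mul_nonneg (by positivity) (sub_nonneg.2 this)

theorem coneArg_add (a s X : ℝ) : coneArg a s X (X + s) = 0 := by
  rw [coneArg_eq, show X - (X + s) = -s by ring, Real.cosh_neg, sub_self, mul_zero]

theorem coneArg_sub (a s X : ℝ) : coneArg a s X (X - s) = 0 := by
  rw [coneArg_eq, show X - (X - s) = s by ring, sub_self, mul_zero]

/-- `∂ₛ w`. -/
def coneArgS (a s X y : ℝ) : ℝ := a ^ 2 / 2 * Real.exp (X + y) * Real.sinh s

/-- `∂ₛ² w`. -/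
def coneArgSS (a s X y : ℝ) : ℝ := a ^ 2 / 2 * Real.exp (X + y) * Real.cosh s

/-- `∂_X w`. -/
def coneArgX (a s X y : ℝ) : ℝ :=
  a ^ 2 / 2 * Real.exp (X + y) * Real.cosh s - a ^ 2 / 2 * Real.exp (2 * X)

/-- `∂_X² w`. -/
def coneArgXX (a s X y : ℝ) : ℝ :=
  a ^ 2 / 2 * Real.exp (X + y) * Real.cosh s - a ^ 2 * Real.exp (2 * X)

theorem hasDerivAt_coneArg_s (a s X y : ℝ) :
    HasDerivAt (fun s => coneArg a s X y) (coneArgS a s X y) s :=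
  ((Real.hasDerivAt_cosh s).const_mul _).sub_const _

theorem hasDerivAt_coneArgS (a s X y : ℝ) :
    HasDerivAt (fun s => coneArgS a s X y) (coneArgSS a s X y) s :=
  (Real.hasDerivAt_sinh s).const_mul _

theorem hasDerivAt_exp_two_mul (X : ℝ) :
    HasDerivAt (fun X : ℝ => Real.exp (2 * X)) (2 * Real.exp (2 * X)) X := by
  have := ((hasDerivAt_id X).const_mul 2).exp
  simpa [mul_comm] using this

theorem hasDerivAt_coneArg_X (a s X y : ℝ) :
    HasDerivAt (fun X => coneArg a s X y) (coneArgX a s X y) X := by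
  have h1 : HasDerivAt (fun X : ℝ => Real.exp (X + y)) (Real.exp (X + y)) X := by
    simpa using ((hasDerivAt_id X).add_const y).exp
  refine (((h1.const_mul (a ^ 2 / 2)).mul_const (Real.cosh s)).fun_sub
    (((hasDerivAt_exp_two_mul X).add_const (Real.exp (2 * y))).const_mul
      (a ^ 2 / 4))).congr_deriv ?_
  unfold coneArgX
  ring

theorem hasDerivAt_coneArgX (a s X y : ℝ) :
    HasDerivAt (fun X => coneArgX a s X y) (coneArgXX a s X y) X := by
  have h1 : HasDerivAt (fun X : ℝ => Real.exp (X + y)) (Real.exp (X + y)) X := by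
    simpa using ((hasDerivAt_id X).add_const y).exp
  refine (((h1.const_mul (a ^ 2 / 2)).mul_const (Real.cosh s)).fun_sub
    ((hasDerivAt_exp_two_mul X).const_mul (a ^ 2 / 2))).congr_deriv ?_
  unfold coneArgXX
  ring

theorem hasDerivAt_clifford_comp {w : ℝ → ℝ} {w' x : ℝ} (hw : HasDerivAt w w' x) (n : ℕ) :
    HasDerivAt (fun x => clifford n (w x)) (-(clifford (n + 1) (w x) * w')) x :=
  ((hasDerivAt_clifford n (w x)).comp x hw).congr_deriv (by ring)

theorem hasDerivAt_clifford_comp_deriv {w w' : ℝ → ℝ} {w'' x : ℝ} (hw : HasDerivAt w (w' x) x)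
    (hw' : HasDerivAt w' w'' x) :
    HasDerivAt (fun x => -(clifford 1 (w x) * w' x))
      (clifford 2 (w x) * (w' x * w' x) - clifford 1 (w x) * w'') x := by
  refine ((hasDerivAt_clifford_comp hw 1).fun_mul hw').fun_neg.congr_deriv ?_
  norm_num
  ring

/-- The Riemann function of the wave equation. -/
def riemann (a s X y : ℝ) : ℝ := clifford 0 (coneArg a s X y)

/-- `∂ₛ R` for the Riemann function `R`. -/
def riemannS (a s X y : ℝ) : ℝ := -(clifford 1 (coneArg a s X y) * coneArgS a s X y)

/-- `∂ₛ² R` for the Riemann function `R`. -/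
def riemannSS (a s X y : ℝ) : ℝ :=
  clifford 2 (coneArg a s X y) * (coneArgS a s X y * coneArgS a s X y) -
    clifford 1 (coneArg a s X y) * coneArgSS a s X y

/-- `∂_X R` for the Riemann function `R`. -/
def riemannX (a s X y : ℝ) : ℝ := -(clifford 1 (coneArg a s X y) * coneArgX a s X y)

/-- `∂_X² R` for the Riemann function `R`. -/
def riemannXX (a s X y : ℝ) : ℝ :=
  clifford 2 (coneArg a s X y) * (coneArgX a s X y * coneArgX a s X y) -
    clifford 1 (coneArg a s X y) * coneArgXX a s X y

/-- From `wₛ² - w_X² = a² e^{2X} w` and `wₛₛ - w_XX = a² e^{2X}`, the d'Alembertian of `C₀(w)` is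
`a² e^{2X} (w C₂ - C₁)`, which the recurrence identifies with `-a² e^{2X} C₀`. -/
theorem riemann_wave (a s X y : ℝ) :
    riemannSS a s X y = riemannXX a s X y - a ^ 2 * Real.exp (2 * X) * riemann a s X y := by
  have hr := clifford_recurrence 0 (coneArg a s X y)
  norm_num at hr
  have hw : coneArgS a s X y * coneArgS a s X y - coneArgX a s X y * coneArgX a s X y =
      a ^ 2 * Real.exp (2 * X) * coneArg a s X y := by
    unfold coneArgS coneArgX coneArg
    have h1 := Real.cosh_sq s
    have h2 : Real.exp (X + y) ^ 2 = Real.exp (2 * X) * Real.exp (2 * y) := by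
      rw [← Real.exp_nat_mul, ← Real.exp_add]
      congr 1
      push_cast
      ring
    linear_combination (-(a ^ 4 / 4 * Real.exp (X + y) ^ 2)) * h1 - a ^ 4 / 4 * h2
  have hw2 : coneArgSS a s X y - coneArgXX a s X y = a ^ 2 * Real.exp (2 * X) := by
    unfold coneArgSS coneArgXX
    ring
  unfold riemannSS riemannXX riemann
  rw [hr]
  linear_combination clifford 2 (coneArg a s X y) * hw - clifford 1 (coneArg a s X y) * hw2

theorem riemann_add (a s X : ℝ) : riemann a s X (X + s) = 1 := by
  simp [riemann, coneArg_add, clifford_zero_right]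

theorem riemann_sub (a s X : ℝ) : riemann a s X (X - s) = 1 := by
  simp [riemann, coneArg_sub, clifford_zero_right]

/-- Moving `(s, X)` in the direction `(1, -1)` with `y` fixed stays on the edge `y = X + s`, where
`R = 1`. On the other edge the direction is `(1, 1)`, hence the sign in `riemannS_sub`. -/
theorem riemannS_add (a s X : ℝ) : riemannS a s X (X + s) = riemannX a s X (X + s) := by
  unfold riemannS riemannX coneArgS coneArgX
  rw [Real.cosh_eq, Real.sinh_eq, show X + (X + s) = 2 * X + s by ring, Real.exp_add,
    Real.exp_neg]
  field_simp
  ring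

theorem riemannS_sub (a s X : ℝ) : riemannS a s X (X - s) = -riemannX a s X (X - s) := by
  unfold riemannS riemannX coneArgS coneArgX
  rw [Real.cosh_eq, Real.sinh_eq, show X + (X - s) = 2 * X - s by ring, Real.exp_sub,
    Real.exp_neg]
  field_simp
  ring

theorem cosh_le_exp_abs (s : ℝ) : Real.cosh s ≤ Real.exp |s| := by
  rw [← Real.cosh_abs, Real.cosh_eq]
  have : Real.exp (-|s|) ≤ Real.exp |s| := Real.exp_le_exp.2 (by linarith [abs_nonneg s])
  linarith

theorem abs_sinh_le_exp_abs (s : ℝ) : |Real.sinh s| ≤ Real.exp |s| := by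
  refine le_trans ?_ (cosh_le_exp_abs s)
  rw [Real.abs_sinh, ← Real.cosh_abs s]
  exact (Real.sinh_lt_cosh _).le

theorem exp_add_le_of_cone {R s X y : ℝ} (hX : |X| ≤ R) (hy : |y - X| ≤ |s|) :
    Real.exp (X + y) ≤ Real.exp (2 * R) * Real.exp |s| := by
  rw [← Real.exp_add]
  have h1 := (abs_le.1 hX).2
  have h2 := (abs_le.1 hy).2
  exact Real.exp_le_exp.2 (by linarith)

theorem coneSubgaussian_of_le {f : ℝ → ℝ → ℝ → ℝ} {g : ℝ → ℝ} (c : ℝ)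
    (hg : Continuous g) (hb : ∀ s, |g s| ≤ Real.exp |s|)
    (hf : ∀ s X y, f s X y = c * Real.exp (X + y) * g s) : ConeSubgaussian f := by
  obtain rfl : f = fun s X y => c * Real.exp (X + y) * g s := by
    funext s X y
    exact hf s X y
  refine ConeSubgaussian.of_exp_bound (by fun_prop) fun R =>
    ⟨|c| * Real.exp (2 * R), 2, by positivity, fun s X y hX hy => ?_⟩
  rw [norm_mul, norm_mul, Real.norm_eq_abs, Real.norm_of_nonneg (Real.exp_pos _).le,
    show |c| * Real.exp (2 * R) * Real.exp (2 * |s|) =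
      |c| * (Real.exp (2 * R) * Real.exp |s|) * Real.exp |s| by
        rw [show 2 * |s| = |s| + |s| by ring, Real.exp_add |s|]; ring]
  exact mul_le_mul (mul_le_mul_of_nonneg_left (exp_add_le_of_cone hX hy) (abs_nonneg c)) (hb s)
    (norm_nonneg _) (by positivity)

theorem coneSubgaussian_exp_two_mul (c : ℝ) :
    ConeSubgaussian fun _ X _ : ℝ => c * Real.exp (2 * X) := by
  refine ConeSubgaussian.of_exp_bound (by fun_prop) fun R =>
    ⟨|c| * Real.exp (2 * R), 0, by positivity, fun s X y hX hy => ?_⟩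
  rw [norm_mul, Real.norm_eq_abs, Real.norm_of_nonneg (Real.exp_pos _).le, zero_mul, Real.exp_zero,
    mul_one]
  gcongr
  exact (abs_le.1 hX).2

theorem coneSubgaussian_coneArgS (a : ℝ) : ConeSubgaussian (coneArgS a) :=
  coneSubgaussian_of_le (a ^ 2 / 2) Real.continuous_sinh abs_sinh_le_exp_abs fun _ _ _ => rfl

theorem coneSubgaussian_coneArgSS (a : ℝ) : ConeSubgaussian (coneArgSS a) :=
  coneSubgaussian_of_le (a ^ 2 / 2) Real.continuous_cosh
    (fun s => by rw [abs_of_pos (Real.cosh_pos s)]; exact cosh_le_exp_abs s) fun _ _ _ => rfl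

theorem coneSubgaussian_coneArgX (a : ℝ) : ConeSubgaussian (coneArgX a) :=
  (coneSubgaussian_coneArgSS a).sub (coneSubgaussian_exp_two_mul (a ^ 2 / 2))

theorem coneSubgaussian_coneArgXX (a : ℝ) : ConeSubgaussian (coneArgXX a) :=
  (coneSubgaussian_coneArgSS a).sub (coneSubgaussian_exp_two_mul (a ^ 2))

theorem continuous_coneArg (a : ℝ) :
    Continuous fun p : ℝ × ℝ × ℝ => coneArg a p.1 p.2.1 p.2.2 := by
  unfold coneArg
  fun_prop

/-- The restriction to the cone matters here: there the argument is nonnegative and the bound by `1`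
applies. -/
theorem coneSubgaussian_clifford (a : ℝ) (n : ℕ) :
    ConeSubgaussian fun s X y => clifford n (coneArg a s X y) :=
  ConeSubgaussian.of_exp_bound ((continuous_clifford n).comp (continuous_coneArg a)) fun R =>
    ⟨1, 0, zero_le_one, fun s X y _ hy => by
      simpa using abs_clifford_le_one n (coneArg_nonneg a hy)⟩

theorem coneSubgaussian_riemannS (a : ℝ) : ConeSubgaussian (riemannS a) :=
  ((coneSubgaussian_clifford a 1).smul (coneSubgaussian_coneArgS a)).neg

theorem coneSubgaussian_riemannSS (a : ℝ) : ConeSubgaussian (riemannSS a) :=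
  ((coneSubgaussian_clifford a 2).smul
    ((coneSubgaussian_coneArgS a).smul (coneSubgaussian_coneArgS a))).sub
    ((coneSubgaussian_clifford a 1).smul (coneSubgaussian_coneArgSS a))

theorem coneSubgaussian_riemannX (a : ℝ) : ConeSubgaussian (riemannX a) :=
  ((coneSubgaussian_clifford a 1).smul (coneSubgaussian_coneArgX a)).neg

theorem coneSubgaussian_riemannXX (a : ℝ) : ConeSubgaussian (riemannXX a) :=
  ((coneSubgaussian_clifford a 2).smul
    ((coneSubgaussian_coneArgX a).smul (coneSubgaussian_coneArgX a))).sub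
    ((coneSubgaussian_clifford a 1).smul (coneSubgaussian_coneArgXX a))

theorem coneSubgaussian_riemann (a : ℝ) : ConeSubgaussian (riemann a) :=
  coneSubgaussian_clifford a 0

/-- The integral of `f(s, X, ·) v` over the base of the light cone. -/
def coneIntegral (f : ℝ → ℝ → ℝ → ℝ) (v : ℝ → ℂ) (s X : ℝ) : ℂ :=
  ∫ y in (X - s)..(X + s), f s X y • v y

theorem hasDerivAt_coneIntegral_s {f f' : ℝ → ℝ → ℝ → ℝ} {v : ℝ → ℂ} (hv : Continuous v)
    (hf : Continuous fun p : ℝ × ℝ × ℝ => f p.1 p.2.1 p.2.2)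
    (hf' : Continuous fun p : ℝ × ℝ × ℝ => f' p.1 p.2.1 p.2.2)
    (hd : ∀ s X y, HasDerivAt (fun σ => f σ X y) (f' s X y) s) (s X : ℝ) :
    HasDerivAt (fun σ => coneIntegral f v σ X) (coneIntegral f' v s X +
      (f s X (X + s) • v (X + s) + f s X (X - s) • v (X - s))) s := by
  have hc : ∀ {g : ℝ → ℝ → ℝ → ℝ}, (Continuous fun p : ℝ × ℝ × ℝ => g p.1 p.2.1 p.2.2) →
      Continuous (uncurry fun s y => g s X y • v y) := fun hg =>
    (hg.comp (by fun_prop : Continuous fun p : ℝ × ℝ => ((p.1, X, p.2) : ℝ × ℝ × ℝ))).smul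
      (hv.comp continuous_snd)
  refine (hasDerivAt_intervalIntegral_leibniz (hc hf) (hc hf')
    (fun σ y => (hd σ X y).smul_const (v y)) ((hasDerivAt_id s).const_sub X)
    ((hasDerivAt_id s).const_add X)).congr_deriv ?_
  simp only [id, one_smul, neg_smul, sub_neg_eq_add]
  rfl

theorem hasDerivAt_coneIntegral_X {f f' : ℝ → ℝ → ℝ → ℝ} {v : ℝ → ℂ} (hv : Continuous v)
    (hf : Continuous fun p : ℝ × ℝ × ℝ => f p.1 p.2.1 p.2.2)
    (hf' : Continuous fun p : ℝ × ℝ × ℝ => f' p.1 p.2.1 p.2.2)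
    (hd : ∀ s X y, HasDerivAt (fun ξ => f s ξ y) (f' s X y) X) (s X : ℝ) :
    HasDerivAt (coneIntegral f v s) (coneIntegral f' v s X +
      (f s X (X + s) • v (X + s) - f s X (X - s) • v (X - s))) X := by
  have hc : ∀ {g : ℝ → ℝ → ℝ → ℝ}, (Continuous fun p : ℝ × ℝ × ℝ => g p.1 p.2.1 p.2.2) →
      Continuous (uncurry fun ξ y => g s ξ y • v y) := fun hg =>
    (hg.comp (by fun_prop : Continuous fun p : ℝ × ℝ => ((s, p.1, p.2) : ℝ × ℝ × ℝ))).smul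
      (hv.comp continuous_snd)
  refine (hasDerivAt_intervalIntegral_leibniz (hc hf) (hc hf')
    (fun ξ y => (hd s ξ y).smul_const (v y)) ((hasDerivAt_id X).sub_const s)
    ((hasDerivAt_id X).add_const s)).congr_deriv ?_
  simp only [id, one_smul]
  rfl

theorem ConeSubgaussian.of_bounded {v : ℝ → ℂ} (hv : Continuous v) {M : ℝ}
    (hM : ∀ y, ‖v y‖ ≤ M) : ConeSubgaussian fun _ _ y : ℝ => v y :=
  ConeSubgaussian.of_exp_bound (hv.comp (by fun_prop)) fun R =>
    ⟨M, 0, (norm_nonneg _).trans (hM 0), fun s X y _ _ => by simpa using hM y⟩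

theorem ConeSubgaussian.comp_add {E : Type*} [NormedAddCommGroup E] {f : ℝ → ℝ → ℝ → E}
    (hf : ConeSubgaussian f) :
    Subgaussian fun s X => f s X (X + s) := by
  simpa using hf.comp_endpoint (ε := 1) (by simp)

theorem ConeSubgaussian.comp_sub {E : Type*} [NormedAddCommGroup E] {f : ℝ → ℝ → ℝ → E}
    (hf : ConeSubgaussian f) :
    Subgaussian fun s X => f s X (X - s) := by
  simpa [← sub_eq_add_neg] using hf.comp_endpoint (ε := -1) (by simp)

/-- The solution `P` of `∂ₛ² P = M^a P` with `P = 0`, `∂ₛ P = v` at `s = 0`. -/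
def wave (a : ℝ) (v : ℝ → ℂ) (s X : ℝ) : ℂ := (1 / 2 : ℝ) • coneIntegral (riemann a) v s X

/-- `∂ₛ P` for `P = wave a v`. -/
def waveS (a : ℝ) (v : ℝ → ℂ) (s X : ℝ) : ℂ :=
  (1 / 2 : ℝ) • (coneIntegral (riemannS a) v s X + (v (X + s) + v (X - s)))

/-- `∂ₛ² P` for `P = wave a v`. -/
def waveSS (a : ℝ) (v : ℝ → ℂ) (s X : ℝ) : ℂ :=
  (1 / 2 : ℝ) • (coneIntegral (riemannSS a) v s X +
    (riemannS a s X (X + s) • v (X + s) + riemannS a s X (X - s) • v (X - s)) +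
    (deriv v (X + s) - deriv v (X - s)))

/-- `∂_X P` for `P = wave a v`. -/
def waveX (a : ℝ) (v : ℝ → ℂ) (s X : ℝ) : ℂ :=
  (1 / 2 : ℝ) • (coneIntegral (riemannX a) v s X + (v (X + s) - v (X - s)))

/-- `∂_X² P` for `P = wave a v`. -/
def waveXX (a : ℝ) (v : ℝ → ℂ) (s X : ℝ) : ℂ :=
  (1 / 2 : ℝ) • (coneIntegral (riemannXX a) v s X +
    (riemannX a s X (X + s) • v (X + s) - riemannX a s X (X - s) • v (X - s)) +
    (deriv v (X + s) - deriv v (X - s)))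

section Wave

variable (a : ℝ) {v : ℝ → ℂ}

theorem waveS_zero (X : ℝ) : waveS a v 0 X = v X := by
  simp only [waveS, coneIntegral, sub_zero, add_zero, intervalIntegral.integral_same, zero_add]
  rw [← two_smul ℝ, smul_smul]
  norm_num

/-- The Riemann function is even in `s`, and the limits of integration are exchanged. Oddness of `P`
later folds the Gaussian integral onto `s > 0`. -/
theorem wave_neg (s X : ℝ) : wave a v (-s) X = -wave a v s X := by
  unfold wave coneIntegral
  rw [intervalIntegral.integral_symm, sub_neg_eq_add, ← sub_eq_add_neg, smul_neg]
  simp only [riemann, coneArg, Real.cosh_neg]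

theorem hasDerivAt_wave_s (hv : Continuous v) (s X : ℝ) :
    HasDerivAt (fun σ => wave a v σ X) (waveS a v s X) s := by
  refine ((hasDerivAt_coneIntegral_s hv (coneSubgaussian_riemann a).cont
    (coneSubgaussian_riemannS a).cont
    (fun s X y => hasDerivAt_clifford_comp (hasDerivAt_coneArg_s a s X y) 0)
    s X).fun_const_smul (1 / 2 : ℝ)).congr_deriv ?_
  rw [riemann_add, riemann_sub, one_smul, one_smul, waveS]

theorem hasDerivAt_wave_X (hv : Continuous v) (s X : ℝ) :
    HasDerivAt (wave a v s) (waveX a v s X) X := by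
  refine ((hasDerivAt_coneIntegral_X hv (coneSubgaussian_riemann a).cont
    (coneSubgaussian_riemannX a).cont
    (fun s X y => hasDerivAt_clifford_comp (hasDerivAt_coneArg_X a s X y) 0)
    s X).fun_const_smul (1 / 2 : ℝ)).congr_deriv ?_
  rw [riemann_add, riemann_sub, one_smul, one_smul, waveX]

theorem hasDerivAt_waveS (hv : Continuous v) (hd : Differentiable ℝ v) (s X : ℝ) :
    HasDerivAt (fun σ => waveS a v σ X) (waveSS a v s X) s := by
  have h1 := hasDerivAt_coneIntegral_s hv (coneSubgaussian_riemannS a).cont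
    (coneSubgaussian_riemannSS a).cont
    (fun s X y => hasDerivAt_clifford_comp_deriv (hasDerivAt_coneArg_s a s X y)
      (hasDerivAt_coneArgS a s X y)) s X
  have h2 : HasDerivAt (fun σ => v (X + σ)) (deriv v (X + s)) s :=
    (hd (X + s)).hasDerivAt.comp_const_add X s
  have h3 : HasDerivAt (fun σ => v (X - σ)) (-deriv v (X - s)) s :=
    (hd (X - s)).hasDerivAt.comp_const_sub X s
  refine ((h1.fun_add (h2.fun_add h3)).fun_const_smul (1 / 2 : ℝ)).congr_deriv ?_
  rw [waveSS, ← sub_eq_add_neg]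

theorem hasDerivAt_waveX (hv : Continuous v) (hd : Differentiable ℝ v) (s X : ℝ) :
    HasDerivAt (waveX a v s) (waveXX a v s X) X := by
  have h1 := hasDerivAt_coneIntegral_X hv (coneSubgaussian_riemannX a).cont
    (coneSubgaussian_riemannXX a).cont
    (fun s X y => hasDerivAt_clifford_comp_deriv (hasDerivAt_coneArg_X a s X y)
      (hasDerivAt_coneArgX a s X y)) s X
  have h2 : HasDerivAt (fun σ => v (σ + s)) (deriv v (X + s)) X :=
    (hd (X + s)).hasDerivAt.comp_add_const X s
  have h3 : HasDerivAt (fun σ => v (σ - s)) (deriv v (X - s)) X :=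
    (hd (X - s)).hasDerivAt.comp_sub_const X s
  exact (h1.fun_add (h2.fun_sub h3)).fun_const_smul (1 / 2 : ℝ)

/-- Under the integral this is `riemann_wave`; the boundary terms agree by `riemannS_add` and
`riemannS_sub`, and the terms in `deriv v` are the same on both sides. -/
theorem wave_equation (hv : Continuous v) (s X : ℝ) :
    waveSS a v s X = waveXX a v s X - (a ^ 2 * Real.exp (2 * X)) • wave a v s X := by
  have hi : ∀ {g : ℝ → ℝ → ℝ → ℝ}, (Continuous fun p : ℝ × ℝ × ℝ => g p.1 p.2.1 p.2.2) →
      ∀ a b, IntervalIntegrable (fun y => g s X y • v y) volume a b := fun hg a b =>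
    ((hg.comp (by fun_prop : Continuous fun y : ℝ => ((s, X, y) : ℝ × ℝ × ℝ))).smul
      hv).intervalIntegrable a b
  have h : coneIntegral (riemannSS a) v s X = coneIntegral (riemannXX a) v s X -
      (a ^ 2 * Real.exp (2 * X)) • coneIntegral (riemann a) v s X := by
    have h0 : IntervalIntegrable
        (fun y => (a ^ 2 * Real.exp (2 * X)) • (riemann a s X y • v y)) volume (X - s) (X + s) :=
      (hi (coneSubgaussian_riemann a).cont (X - s) (X + s)).smul (a ^ 2 * Real.exp (2 * X))
    unfold coneIntegral
    rw [← intervalIntegral.integral_smul, ← intervalIntegral.integral_sub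
      (hi (coneSubgaussian_riemannXX a).cont _ _) h0]
    refine intervalIntegral.integral_congr fun y _ => ?_
    simp only [riemann_wave, sub_smul, mul_smul]
  unfold waveSS waveXX wave
  rw [h, riemannS_add, riemannS_sub, smul_comm _ (1 / 2 : ℝ), ← smul_sub, neg_smul]
  congr 1
  abel

theorem norm_wave_le {M : ℝ} (hM : ∀ y, ‖v y‖ ≤ M) (s X : ℝ) : ‖wave a v s X‖ ≤ M * |s| := by
  have h : ‖coneIntegral (riemann a) v s X‖ ≤ M * |X + s - (X - s)| := by
    refine intervalIntegral.norm_integral_le_of_norm_le_const fun y hy => ?_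
    rw [norm_smul]
    exact (mul_le_of_le_one_left (norm_nonneg _)
      (abs_clifford_le_one 0 (coneArg_nonneg a (abs_sub_le_of_mem_uIoc hy)))).trans (hM y)
  rw [show X + s - (X - s) = 2 * s by ring, abs_mul, abs_two] at h
  rw [wave, norm_smul, Real.norm_of_nonneg (by norm_num)]
  linarith

theorem ConeSubgaussian.subgaussian_coneIntegral {f : ℝ → ℝ → ℝ → ℝ} (hf : ConeSubgaussian f)
    (hv : ConeSubgaussian fun _ _ => v) : Subgaussian (coneIntegral f v) :=
  (hf.smul hv).intervalIntegral

theorem subgaussian_wave (hv : ConeSubgaussian fun _ _ => v) : Subgaussian (wave a v) :=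
  ((coneSubgaussian_riemann a).subgaussian_coneIntegral hv).const_smul _

theorem subgaussian_waveS (hv : ConeSubgaussian fun _ _ => v) : Subgaussian (waveS a v) :=
  (((coneSubgaussian_riemannS a).subgaussian_coneIntegral hv).add
    (hv.comp_add.add hv.comp_sub)).const_smul _

theorem subgaussian_waveSS (hv : ConeSubgaussian fun _ _ => v)
    (hv' : ConeSubgaussian fun _ _ => deriv v) : Subgaussian (waveSS a v) :=
  ((((coneSubgaussian_riemannSS a).subgaussian_coneIntegral hv).add
    (((coneSubgaussian_riemannS a).smul hv).comp_add.add
      ((coneSubgaussian_riemannS a).smul hv).comp_sub)).add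
    (hv'.comp_add.sub hv'.comp_sub)).const_smul _

theorem subgaussian_waveX (hv : ConeSubgaussian fun _ _ => v) : Subgaussian (waveX a v) :=
  (((coneSubgaussian_riemannX a).subgaussian_coneIntegral hv).add
    (hv.comp_add.sub hv.comp_sub)).const_smul _

theorem subgaussian_waveXX (hv : ConeSubgaussian fun _ _ => v)
    (hv' : ConeSubgaussian fun _ _ => deriv v) : Subgaussian (waveXX a v) :=
  ((((coneSubgaussian_riemannXX a).subgaussian_coneIntegral hv).add
    (((coneSubgaussian_riemannX a).smul hv).comp_add.sub
      ((coneSubgaussian_riemannX a).smul hv).comp_sub)).add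
    (hv'.comp_add.sub hv'.comp_sub)).const_smul _

end Wave

/-! ### The heat kernel -/

theorem abs_besselJ0_le_one (z : ℝ) : |besselJ0 z| ≤ 1 := by
  rw [besselJ0_eq_clifford]
  exact abs_clifford_le_one 0 (by positivity)

theorem continuous_besselJ0 : Continuous besselJ0 := by
  rw [funext besselJ0_eq_clifford]
  exact (continuous_clifford 0).comp (by fun_prop)

theorem continuous_heatIntegrand (a t X : ℝ) :
    Continuous fun p : ℝ × ℝ => heatIntegrand a t X p.1 p.2 := by
  unfold heatIntegrand
  exact (by fun_prop : Continuous fun p : ℝ × ℝ => p.2 * Real.exp (-p.2 ^ 2 / (4 * t))).mul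
    (continuous_besselJ0.comp (by fun_prop))

theorem norm_heatIntegrand_le (a t X X' s : ℝ) :
    ‖heatIntegrand a t X X' s‖ ≤ |s| * Real.exp (-s ^ 2 / (4 * t)) := by
  unfold heatIntegrand
  rw [norm_mul, norm_mul, Real.norm_of_nonneg (Real.exp_pos _).le]
  exact mul_le_of_le_one_right (by positivity) (abs_besselJ0_le_one _)

theorem integrable_abs_mul_exp {t : ℝ} (ht : 0 < t) :
    Integrable fun s : ℝ => |s| * Real.exp (-s ^ 2 / (4 * t)) := by
  have h := (integrable_mul_exp_neg_mul_sq (b := 1 / (4 * t)) (by positivity)).norm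
  refine h.congr (Eventually.of_forall fun s => ?_)
  simp only [norm_mul, Real.norm_eq_abs, Real.abs_exp]
  congr 2
  ring

theorem integrable_heatIntegrand (a X X' : ℝ) {t : ℝ} (ht : 0 < t) :
    Integrable fun s => heatIntegrand a t X X' s :=
  (integrable_abs_mul_exp ht).mono'
    ((continuous_heatIntegrand a t X).comp (Continuous.prodMk_right X')).aestronglyMeasurable
    (Eventually.of_forall fun s => norm_heatIntegrand_le a t X X' s)

/-- By `cosh²(x/2) = (cosh x + 1)/2`, a quarter of the square of the Bessel argument is `w`; the
cone condition keeps the radicand nonnegative. -/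
theorem heatIntegrand_eq_riemann (a t : ℝ) {X X' s : ℝ} (h : |X - X'| ≤ |s|) :
    heatIntegrand a t X X' s = s * Real.exp (-s ^ 2 / (4 * t)) * riemann a s X X' := by
  have hcosh : ∀ x : ℝ, Real.cosh (x / 2) ^ 2 = (Real.cosh x + 1) / 2 := fun x => by
    have h1 := Real.cosh_two_mul (x / 2)
    rw [Real.sinh_sq, show 2 * (x / 2) = x by ring] at h1
    linarith
  have hle : Real.cosh (X - X') ≤ Real.cosh s := Real.cosh_le_cosh.2 h
  unfold heatIntegrand riemann
  rw [besselJ0_eq_clifford, coneArg_eq, mul_pow, hcosh, hcosh, Real.sq_sqrt (by linarith), mul_pow,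
    mul_pow, sq_abs, ← Real.exp_nat_mul]
  congr 2
  rw [show ((2 : ℕ) : ℝ) * ((X + X') / 2) = X + X' by push_cast; ring]
  ring

/-- The integrand of the double integral that represents the solution. -/
def coneIntegrand (a t X : ℝ) (v : ℝ → ℂ) : ℝ × ℝ → ℂ :=
  {p : ℝ × ℝ | |X - p.1| < p.2}.indicator fun p => heatIntegrand a t X p.1 p.2 • v p.1

/-- The bound `|J₀| ≤ 1` gives the product majorant `‖v(y)‖ · |s| exp(-s²/4t)`. This justifies
Fubini. -/
theorem integrable_coneIntegrand (a X : ℝ) {t : ℝ} (ht : 0 < t) {v : ℝ → ℂ} (hv : Continuous v)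
    (hvi : Integrable v) : Integrable (coneIntegrand a t X v) (volume.prod volume) := by
  have hset : MeasurableSet {p : ℝ × ℝ | |X - p.1| < p.2} :=
    (isOpen_lt (by fun_prop) (by fun_prop)).measurableSet
  refine Integrable.indicator ?_ hset
  refine (hvi.norm.mul_prod (integrable_abs_mul_exp ht)).mono'
    ((continuous_heatIntegrand a t X).smul (hv.comp continuous_fst)).aestronglyMeasurable
    (Eventually.of_forall fun p => ?_)
  rw [norm_smul, mul_comm]
  exact mul_le_mul_of_nonneg_left (norm_heatIntegrand_le a t X p.1 p.2) (norm_nonneg _)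

theorem integral_coneIntegrand_snd (a t X y : ℝ) (v : ℝ → ℂ) :
    ∫ s, coneIntegrand a t X v (y, s) =
      (∫ s in Ioi |X - y|, heatIntegrand a t X y s) • v y := by
  rw [← integral_smul_const, ← integral_indicator measurableSet_Ioi]
  rfl

theorem integral_coneIntegrand_fst (a t X : ℝ) (v : ℝ → ℂ) {s : ℝ} (hs : 0 < s) :
    ∫ y, coneIntegrand a t X v (y, s) =
      (2 : ℝ) • Real.exp (-s ^ 2 / (4 * t)) • (s • wave a v s X) := by
  have hset : {y : ℝ | |X - y| < s} = Ioo (X - s) (X + s) := by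
    ext y
    rw [mem_ofPred_eq, mem_Ioo, abs_lt]
    constructor <;> rintro ⟨h1, h2⟩ <;> constructor <;> linarith
  have h1 : (fun y => coneIntegrand a t X v (y, s)) =
      (Ioo (X - s) (X + s)).indicator fun y =>
        (s * Real.exp (-s ^ 2 / (4 * t))) • (riemann a s X y • v y) := by
    rw [← hset]
    ext y
    by_cases hy : |X - y| < s
    · rw [indicator_of_mem (show y ∈ {y : ℝ | |X - y| < s} from hy), coneIntegrand,
        indicator_of_mem (show (y, s) ∈ {p : ℝ × ℝ | |X - p.1| < p.2} from hy)]
      rw [heatIntegrand_eq_riemann a t (by rw [abs_of_pos hs]; exact hy.le), mul_smul]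
    · rw [indicator_of_notMem (show y ∉ {y : ℝ | |X - y| < s} from hy), coneIntegrand,
        indicator_of_notMem (show (y, s) ∉ {p : ℝ × ℝ | |X - p.1| < p.2} from hy)]
  rw [h1, integral_indicator measurableSet_Ioo, integral_smul, ← integral_Ioc_eq_integral_Ioo,
    ← intervalIntegral.integral_of_le (by linarith)]
  unfold wave coneIntegral
  simp only [smul_smul]
  congr 1
  ring

theorem integral_coneIntegrand_fst_of_nonpos (a t X : ℝ) (v : ℝ → ℂ) {s : ℝ} (hs : s ≤ 0) :
    ∫ y, coneIntegrand a t X v (y, s) = 0 := by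
  have h1 : ∀ y, coneIntegrand a t X v (y, s) = 0 := fun y =>
    indicator_of_notMem (show (y, s) ∉ {p : ℝ × ℝ | |X - p.1| < p.2} from
      (hs.trans (abs_nonneg (X - y))).not_gt) _
  simp [h1]

theorem heatKernel_smul_eq (a t X y : ℝ) (v : ℝ → ℂ) :
    (heatKernel a t X y : ℂ) * v y = (1 / (4 * Real.sqrt Real.pi * t ^ (3 / 2 : ℝ))) •
      ∫ s, coneIntegrand a t X v (y, s) := by
  rw [integral_coneIntegrand_snd, smul_smul, Complex.real_smul]
  rfl

theorem integrable_heatKernel_mul (a X : ℝ) {t : ℝ} (ht : 0 < t) {v : ℝ → ℂ} (hv : Continuous v)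
    (hvi : Integrable v) : Integrable fun y : ℝ => (heatKernel a t X y : ℂ) * v y := by
  simp only [heatKernel_smul_eq]
  exact (integrable_coneIntegrand a X ht hv hvi).integral_prod_left.smul
    (1 / (4 * Real.sqrt Real.pi * t ^ (3 / 2 : ℝ)))

/-- Slices of the cone at fixed `y` give the kernel, slices at fixed `s > 0` give the wave solution.
After Fubini, evenness of `s P` extends the integral from the half-line to the line. -/
theorem integral_heatKernel_mul (a X : ℝ) {t : ℝ} (ht : 0 < t) {v : ℝ → ℂ} (hv : Continuous v)
    (hvi : Integrable v) (hbv : ConeSubgaussian fun _ _ => v) :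
    ∫ y : ℝ, (heatKernel a t X y : ℂ) * v y =
      (2 * t)⁻¹ • gaussMean (fun s X => s • wave a v s X) t X := by
  set g : ℝ → ℂ := fun s => Real.exp (-s ^ 2 / (4 * t)) • (s • wave a v s X) with hg
  have heven : ∀ s, g (-s) = g s := fun s => by
    simp only [hg, wave_neg, neg_smul_neg, neg_sq]
  have hgi : Integrable g := (subgaussian_fst.smul (subgaussian_wave a hbv)).integrable_heat ht X
  have h1 : ∫ s, g s = (2 : ℝ) • ∫ s in Ioi 0, g s := by
    have h := integral_comp_neg_Ioi 0 g
    simp only [heven, neg_zero] at h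
    rw [← intervalIntegral.integral_Iic_add_Ioi (b := 0) hgi.integrableOn hgi.integrableOn, ← h,
      two_smul]
  have h2 : ∫ s, ∫ y, coneIntegrand a t X v (y, s) = (2 : ℝ) • ∫ s in Ioi 0, g s := by
    rw [← integral_smul, ← integral_indicator measurableSet_Ioi]
    refine integral_congr_ae (Eventually.of_forall fun s => ?_)
    by_cases hs : 0 < s
    · rw [indicator_of_mem (show s ∈ Ioi 0 from hs)]
      exact integral_coneIntegrand_fst a t X v hs
    · rw [indicator_of_notMem (show s ∉ Ioi 0 from hs)]
      exact integral_coneIntegrand_fst_of_nonpos a t X v (not_lt.1 hs)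
  simp only [heatKernel_smul_eq]
  rw [integral_smul, integral_integral_swap (f := fun y s => coneIntegrand a t X v (y, s))
    (integrable_coneIntegrand a X ht hv hvi), h2, ← h1, gaussMean_eq_integral _ ht, smul_smul]
  congr 1
  -- The constants match because `4 √π t^{3/2} = (2t) · 2√(πt)`.
  rw [show (3 / 2 : ℝ) = 1 + 1 / 2 by norm_num, Real.rpow_add ht, Real.rpow_one,
    ← Real.sqrt_eq_rpow, Real.sqrt_mul Real.pi_pos.le]
  field_simp
  norm_num

/-! ### Uniqueness in the Tychonoff class -/

/-- A positive second derivative would make `x` a local minimum too, so `f` would be locally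
constant and its second derivative zero. -/
theorem deriv_deriv_nonpos_of_isLocalMax {f : ℝ → ℝ} {x : ℝ} (h : IsLocalMax f x)
    (hc : ContinuousAt f x) : deriv (deriv f) x ≤ 0 := by
  by_contra! hpos
  have hmin := isLocalMin_of_deriv_deriv_pos hpos h.deriv_eq_zero hc
  have hconst : f =ᶠ[𝓝 x] fun _ => f x := by
    filter_upwards [h, hmin] with y h1 h2 using le_antisymm h1 h2
  have h1 : deriv f =ᶠ[𝓝 x] fun _ => 0 := by
    filter_upwards [hconst.deriv] with y hy
    simpa using hy
  rw [h1.deriv_eq] at hpos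
  simp at hpos

/-- Only slopes from the left are used, since the maximum may be attained at the final time. -/
theorem deriv_nonneg_of_forall_le {f : ℝ → ℝ} {f' t : ℝ} (ht : 0 < t) (hf : HasDerivAt f f' t)
    (h : ∀ s ∈ Icc 0 t, f s ≤ f t) : 0 ≤ f' := by
  have hs := (hasDerivAt_iff_tendsto_slope_left_right.1 hf).1
  refine ge_of_tendsto hs ?_
  filter_upwards [Ioo_mem_nhdsLT ht] with s hs
  rw [slope_def_field]
  exact div_nonneg_of_nonpos (by linarith [h s ⟨hs.1.le, hs.2.le⟩]) (by linarith [hs.2])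

/-- The barrier used in the maximum principle. -/
def barrier (b t X : ℝ) : ℝ := Real.exp (b * X ^ 2 * (1 + 16 * b * t) + (4 * b + 1) * t)

theorem hasDerivAt_barrier_time (b t X : ℝ) :
    HasDerivAt (fun τ => barrier b τ X)
      (barrier b t X * (16 * b ^ 2 * X ^ 2 + (4 * b + 1))) t := by
  have h1 : HasDerivAt (fun τ : ℝ => b * X ^ 2 * (1 + 16 * b * τ) + (4 * b + 1) * τ)
      (b * X ^ 2 * (16 * b * 1) + (4 * b + 1) * 1) t :=
    ((((hasDerivAt_id t).const_mul (16 * b)).const_add 1).const_mul (b * X ^ 2)).add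
      ((hasDerivAt_id t).const_mul (4 * b + 1))
  refine h1.exp.congr_deriv ?_
  unfold barrier
  ring

theorem hasDerivAt_barrier_space (b t X : ℝ) :
    HasDerivAt (barrier b t) (barrier b t X * (2 * b * (1 + 16 * b * t) * X)) X := by
  have h1 : HasDerivAt (fun X : ℝ => b * X ^ 2 * (1 + 16 * b * t) + (4 * b + 1) * t)
      (b * (2 * X) * (1 + 16 * b * t)) X := by
    simpa using (((hasDerivAt_pow 2 X).const_mul b).mul_const (1 + 16 * b * t)).add_const
      ((4 * b + 1) * t)
  refine h1.exp.congr_deriv ?_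
  unfold barrier
  ring

theorem hasDerivAt_barrier_space_two (b t X : ℝ) :
    HasDerivAt (fun X => barrier b t X * (2 * b * (1 + 16 * b * t) * X))
      (barrier b t X * ((2 * b * (1 + 16 * b * t) * X) ^ 2 + 2 * b * (1 + 16 * b * t))) X := by
  refine ((hasDerivAt_barrier_space b t X).mul
    ((hasDerivAt_id X).const_mul (2 * b * (1 + 16 * b * t)))).congr_deriv ?_
  simp only [id]
  ring

theorem continuous_barrier (b : ℝ) : Continuous (uncurry (barrier b)) := by
  unfold barrier uncurry
  fun_prop

/-- Classical subsolutions of `u_t = u_XX - q u`, `q ≥ 0`, that start at `u ≤ 0` and satisfy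
a Gaussian growth bound stay nonpositive for a short time. -/
theorem nonpos_of_growth_short {q : ℝ → ℝ} (hq : ∀ X, 0 ≤ q X) {u : ℝ → ℝ → ℝ} {b τ C : ℝ}
    (hb : 0 < b) (hτ : 16 * b * τ ≤ 1)
    (hcont : ContinuousOn (uncurry u) (Icc 0 τ ×ˢ univ))
    (h0 : ∀ X, u 0 X ≤ 0)
    (hdt : ∀ t ∈ Ioc 0 τ, ∀ X, DifferentiableAt ℝ (fun σ => u σ X) t)
    (hdx : ∀ t ∈ Ioc 0 τ, ContDiff ℝ 2 (u t))
    (heq : ∀ t ∈ Ioc 0 τ, ∀ X,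
      deriv (fun σ => u σ X) t = deriv (deriv (u t)) X - q X * u t X)
    (hgrowth : ∀ t ∈ Icc 0 τ, ∀ X, u t X ≤ C * Real.exp (b / 2 * X ^ 2)) :
    ∀ t ∈ Icc 0 τ, ∀ X, u t X ≤ 0 := by
  have hτ0 : ∀ t ∈ Icc 0 τ, 0 ≤ 16 * b * t := fun t ht => by
    have := ht.1
    positivity
  have hτ1 : ∀ t ∈ Icc 0 τ, 16 * b * t ≤ 1 := fun t ht =>
    (mul_le_mul_of_nonneg_left ht.2 (by positivity)).trans hτ
  suffices main : ∀ ε > 0, ∀ t ∈ Icc 0 τ, ∀ X, u t X ≤ ε * barrier b t X by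
    intro t ht X
    refine le_of_forall_pos_le_add fun δ hδ => ?_
    have hpos : 0 < barrier b t X := Real.exp_pos _
    have := main (δ / barrier b t X) (by positivity) t ht X
    rwa [div_mul_cancel₀ _ hpos.ne', ← zero_add δ] at this
  intro ε hε t₁ ht₁ X₁
  by_contra! hlt
  -- beyond `|X| = R` the barrier wins
  obtain ⟨R, hR1, hR⟩ : ∃ R, |X₁| < R ∧ ∀ t ∈ Icc 0 τ, ∀ X, R ≤ |X| →
      u t X ≤ ε * barrier b t X := by
    have hlim : Tendsto (fun R : ℝ => ε * Real.exp (b / 2 * R ^ 2)) atTop atTop := by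
      refine Tendsto.const_mul_atTop hε (Real.tendsto_exp_atTop.comp ?_)
      exact Tendsto.const_mul_atTop (half_pos hb) (tendsto_pow_atTop two_ne_zero)
    obtain ⟨R, hR, hRX⟩ := ((hlim.eventually_ge_atTop C).and (eventually_gt_atTop |X₁|)).exists
    refine ⟨R, hRX, fun t ht X hX => ?_⟩
    have hR0 : 0 ≤ R := (abs_nonneg X₁).trans hRX.le
    have hsq : R ^ 2 ≤ X ^ 2 := by
      rw [← sq_abs X]
      gcongr
    have h1 : C ≤ ε * Real.exp (b / 2 * X ^ 2) := by
      refine hR.trans ?_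
      gcongr
    calc u t X ≤ C * Real.exp (b / 2 * X ^ 2) := hgrowth t ht X
      _ ≤ ε * Real.exp (b / 2 * X ^ 2) * Real.exp (b / 2 * X ^ 2) := by gcongr
      _ = ε * Real.exp (b * X ^ 2) := by rw [mul_assoc, ← Real.exp_add]; ring_nf
      _ ≤ ε * barrier b t X := by
        unfold barrier
        gcongr
        have h2 := hτ0 t ht
        have h3 := ht.1
        have h4 : 0 ≤ b * X ^ 2 * (16 * b * t) := by positivity
        have h5 : 0 ≤ (4 * b + 1) * t := by positivity
        linarith
  have hK : IsCompact (Icc (0 : ℝ) τ ×ˢ Icc (-R) R) := isCompact_Icc.prod isCompact_Icc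
  have hX₁ : X₁ ∈ Icc (-R) R := ⟨(abs_lt.1 hR1).1.le, (abs_lt.1 hR1).2.le⟩
  have hvc : ContinuousOn (fun p : ℝ × ℝ => u p.1 p.2 - ε * barrier b p.1 p.2)
      (Icc (0 : ℝ) τ ×ˢ Icc (-R) R) :=
    (hcont.mono (prod_mono le_rfl (subset_univ _))).sub
      ((continuous_barrier b).const_mul ε).continuousOn
  obtain ⟨⟨t, X⟩, ⟨ht, hX⟩, hmax⟩ := hK.exists_isMaxOn ⟨(t₁, X₁), ht₁, hX₁⟩ hvc
  simp only at ht hX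
  have hmax' : ∀ s ∈ Icc 0 τ, ∀ Y ∈ Icc (-R) R,
      u s Y - ε * barrier b s Y ≤ u t X - ε * barrier b t X := fun s hs Y hY =>
    hmax (show (s, Y) ∈ Icc (0 : ℝ) τ ×ˢ Icc (-R) R from ⟨hs, hY⟩)
  have hpos : 0 < u t X - ε * barrier b t X :=
    (sub_pos.2 hlt).trans_le (hmax' t₁ ht₁ X₁ hX₁)
  have hbpos : 0 < ε * barrier b t X := mul_pos hε (Real.exp_pos _)
  have htpos : 0 < t := by
    refine ht.1.lt_of_ne ?_
    rintro rfl
    linarith [h0 X]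
  have hXR : |X| < R := by
    by_contra! hge
    linarith [hR t ht X hge]
  have htm : t ∈ Ioc 0 τ := ⟨htpos, ht.2⟩
  have hdX : Differentiable ℝ (u t) := (hdx t htm).differentiable (by norm_num)
  have hdX2 : Differentiable ℝ (deriv (u t)) := by
    have h : ContDiff ℝ (1 + 1) (u t) := by norm_num; exact hdx t htm
    exact (contDiff_succ_iff_deriv.1 h).2.2.differentiable (by norm_num)
  have htime := deriv_nonneg_of_forall_le htpos
    ((hdt t htm X).hasDerivAt.fun_sub ((hasDerivAt_barrier_time b t X).const_mul ε))
    fun s hs => hmax' s ⟨hs.1, hs.2.trans ht.2⟩ X hX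
  have hv1 : ∀ Y, HasDerivAt (fun Y => u t Y - ε * barrier b t Y)
      (deriv (u t) Y - ε * (barrier b t Y * (2 * b * (1 + 16 * b * t) * Y))) Y := fun Y =>
    (hdX Y).hasDerivAt.fun_sub ((hasDerivAt_barrier_space b t Y).const_mul ε)
  have hv2 := (hdX2 X).hasDerivAt.fun_sub ((hasDerivAt_barrier_space_two b t X).const_mul ε)
  have hlocal : IsLocalMax (fun Y => u t Y - ε * barrier b t Y) X := by
    have hXR' := abs_lt.1 hXR
    filter_upwards [Icc_mem_nhds hXR'.1 hXR'.2] with Y hY using hmax' t ht Y hY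
  have hspace := deriv_deriv_nonpos_of_isLocalMax hlocal (hv1 X).continuousAt
  rw [funext fun Y => (hv1 Y).deriv, hv2.deriv] at hspace
  rw [heq t htm X] at htime
  -- At the maximum `u` exceeds `ε` times the barrier, so `u > 0` and the potential term has the
  -- favourable sign.
  have hqu : 0 ≤ q X * u t X := mul_nonneg (hq X) (by linarith)
  have hk0 := hτ0 t ht
  have hk1 := hτ1 t ht
  -- The barrier is a strict supersolution: `1 + 16bt ≤ 2` bounds the left side by `16b²X² + 4b`,
  -- and the extra `1` in the rate `4b + 1` gives strictness.
  have hcmp : (2 * b * (1 + 16 * b * t) * X) ^ 2 + 2 * b * (1 + 16 * b * t) <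
      16 * b ^ 2 * X ^ 2 + (4 * b + 1) := by
    have h1 : (1 + 16 * b * t) ^ 2 ≤ 2 ^ 2 := by gcongr; linarith
    have h2 : 4 * b ^ 2 * X ^ 2 * (1 + 16 * b * t) ^ 2 ≤ 4 * b ^ 2 * X ^ 2 * 2 ^ 2 := by gcongr
    have h3 : 2 * b * (1 + 16 * b * t) ≤ 2 * b * 2 := by gcongr; linarith
    calc _ = 4 * b ^ 2 * X ^ 2 * (1 + 16 * b * t) ^ 2 + 2 * b * (1 + 16 * b * t) := by ring
      _ < _ := by linarith
  have := mul_lt_mul_of_pos_left hcmp hbpos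
  linarith

theorem nonpos_of_growth {q : ℝ → ℝ} (hq : ∀ X, 0 ≤ q X) {u : ℝ → ℝ → ℝ} {T C c : ℝ}
    (hcont : ContinuousOn (uncurry u) (Ici 0 ×ˢ univ))
    (h0 : ∀ X, u 0 X ≤ 0)
    (hdt : ∀ t, 0 < t → ∀ X, DifferentiableAt ℝ (fun σ => u σ X) t)
    (hdx : ∀ t, 0 < t → ContDiff ℝ 2 (u t))
    (heq : ∀ t, 0 < t → ∀ X,
      deriv (fun σ => u σ X) t = deriv (deriv (u t)) X - q X * u t X)
    (hgrowth : ∀ t ∈ Icc 0 T, ∀ X, u t X ≤ C * Real.exp (c * X ^ 2)) :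
    ∀ t ∈ Icc 0 T, ∀ X, u t X ≤ 0 := by
  -- This ensures `b > 0` and `b / 2 ≥ c`. The growth bound is uniform on `[0, T]`, so `b` and the
  -- step `1 / (16b)` stay the same at every restart.
  set b := 2 * (|c| + 1) with hb
  have hbpos : 0 < b := by positivity
  have hC : ∀ t ∈ Icc 0 T, ∀ X, u t X ≤ |C| * Real.exp (b / 2 * X ^ 2) := fun t ht X => by
    refine (hgrowth t ht X).trans ?_
    gcongr
    · exact le_abs_self C
    · rw [hb]; linarith [le_abs_self c]
  set τ := 1 / (16 * b) with hτ
  have hτpos : 0 < τ := by positivity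
  have step : ∀ n : ℕ, ∀ t ∈ Icc 0 T, t ≤ n * τ → ∀ X, u t X ≤ 0 := by
    intro n
    induction n with
    | zero =>
      intro t ht htn X
      obtain rfl : t = 0 := le_antisymm (by simpa using htn) ht.1
      exact h0 X
    | succ n ih =>
      intro t ht htn X
      rcases le_total t (n * τ) with hle | hle
      · exact ih t ht hle X
      have hnτ : 0 ≤ n * τ := by positivity
      have hσ : t - n * τ ≤ τ := by push_cast at htn; linarith
      have key := nonpos_of_growth_short (q := q) hq (u := fun s X => u (n * τ + s) X) (b := b)
        (τ := t - n * τ) (C := |C|) hbpos ?_ ?_ ?_ ?_ ?_ ?_ ?_ (t - n * τ)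
        ⟨by linarith, le_rfl⟩ X
      · simpa using key
      · calc 16 * b * (t - n * τ) ≤ 16 * b * τ := by gcongr
          _ = 1 := by rw [hτ]; field_simp
      · refine hcont.comp (f := fun p : ℝ × ℝ => (n * τ + p.1, p.2)) (by fun_prop) ?_
        intro p hp
        exact ⟨add_nonneg hnτ hp.1.1, mem_univ _⟩
      · intro Y
        simpa using ih (n * τ) ⟨hnτ, hle.trans ht.2⟩ le_rfl Y
      · intro s hs Y
        exact ((hdt _ (add_pos_of_nonneg_of_pos hnτ hs.1) Y).hasDerivAt.comp_const_add
          _ _).differentiableAt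
      · intro s hs
        exact hdx _ (add_pos_of_nonneg_of_pos hnτ hs.1)
      · intro s hs Y
        rw [deriv_comp_const_add (f := fun σ => u σ Y)]
        exact heq _ (add_pos_of_nonneg_of_pos hnτ hs.1) Y
      · intro s hs Y
        exact hC _ ⟨add_nonneg hnτ hs.1, by linarith [hs.2, ht.2]⟩ Y
  intro t ht X
  obtain ⟨n, hn⟩ := exists_nat_ge (t / τ)
  exact step n t ht ((div_le_iff₀ hτpos).1 hn) X

/-! ### Existence -/

/-- The solution of the heat problem as a Gaussian mean of the solution of the wave equation. -/
def heatSolution (a : ℝ) (v : ℝ → ℂ) : ℝ → ℝ → ℂ := gaussMean (waveS a v)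

/-- The bound goes through `s P`, where `|P| ≤ M |s|`: its mean is at most `2t M K`, and division by
`2t` gives a bound uniform in `t`. At `t = 0`, where this division fails, the initial value is used.
-/
theorem norm_heatSolution_le (a : ℝ) {v : ℝ → ℂ} (hv : Continuous v) {M : ℝ}
    (hM : ∀ y, ‖v y‖ ≤ M) : ∃ C, ∀ t, 0 ≤ t → ∀ X, ‖heatSolution a v t X‖ ≤ C := by
  have hbv : ConeSubgaussian fun _ _ => v := ConeSubgaussian.of_bounded hv hM
  have hM0 : 0 ≤ M := (norm_nonneg _).trans (hM 0)
  set K := (Real.sqrt (2 * Real.pi))⁻¹ * ∫ z : ℝ, Real.exp (-z ^ 2 / 2) * z ^ 2 with hK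
  have hK0 : 0 ≤ K := mul_nonneg (by positivity) (integral_nonneg fun z => by positivity)
  refine ⟨M + M * K, fun t ht X => ?_⟩
  rcases ht.eq_or_lt with rfl | ht
  · rw [heatSolution, gaussMean_zero_left, waveS_zero]
    have := hM X
    nlinarith
  · have h1 := gaussMean_fst_smul (subgaussian_wave a hbv) (subgaussian_waveS a hbv)
      (hasDerivAt_wave_s a hv) ht.le X
    have h2 := norm_gaussMean_le_of_norm_le_sq (Q := fun s X => s • wave a v s X) (X := X) (M := M)
      (fun s => by
        rw [norm_smul, Real.norm_eq_abs, ← sq_abs s]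
        nlinarith [norm_wave_le a hM s X, abs_nonneg s]) ht.le
    rw [h1, norm_smul, Real.norm_of_nonneg (by positivity)] at h2
    have h3 := le_of_mul_le_mul_left h2 (by positivity)
    exact h3.trans (by linarith)

section Existence

variable (a : ℝ) {v : ℝ → ℂ}

/-- Passing from `∂ₛ P` to `s P` saves one derivative: two space derivatives of the solution then
need only the first derivative of `v`. It is also the form that matches the kernel. -/
theorem heatSolution_eq (hv : Continuous v) (hbv : ConeSubgaussian fun _ _ => v) {t : ℝ}
    (ht : 0 < t) (X : ℝ) :
    heatSolution a v t X = (2 * t)⁻¹ • gaussMean (fun s X => s • wave a v s X) t X := by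
  rw [gaussMean_fst_smul (subgaussian_wave a hbv) (subgaussian_waveS a hbv)
    (hasDerivAt_wave_s a hv) ht.le X, smul_smul, inv_mul_cancel₀ (by positivity), one_smul]
  rfl

theorem hasDerivAt_heatSolution_space (hv : Continuous v) (hbv : ConeSubgaussian fun _ _ => v)
    {t : ℝ} (ht : 0 < t) (X : ℝ) :
    HasDerivAt (heatSolution a v t)
      ((2 * t)⁻¹ • gaussMean (fun s X => s • waveX a v s X) t X) X := by
  rw [funext fun X => heatSolution_eq a hv hbv ht X]
  exact (hasDerivAt_gaussMean_space (subgaussian_fst.smul (subgaussian_wave a hbv))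
    (subgaussian_fst.smul (subgaussian_waveX a hbv))
    (fun s X => (hasDerivAt_wave_X a hv s X).fun_const_smul s) t X).fun_const_smul _

theorem hasDerivAt_heatSolution_space_two (hv : Differentiable ℝ v)
    (hbv : ConeSubgaussian fun _ _ => v) (hbv' : ConeSubgaussian fun _ _ => deriv v)
    {t : ℝ} (ht : 0 < t) (X : ℝ) :
    HasDerivAt (deriv (heatSolution a v t))
      ((2 * t)⁻¹ • gaussMean (fun s X => s • waveXX a v s X) t X) X := by
  rw [funext fun X => (hasDerivAt_heatSolution_space a hv.continuous hbv ht X).deriv]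
  exact (hasDerivAt_gaussMean_space (subgaussian_fst.smul (subgaussian_waveX a hbv))
    (subgaussian_fst.smul (subgaussian_waveXX a hbv hbv'))
    (fun s X => (hasDerivAt_waveX a hv.continuous hv s X).fun_const_smul s) t X).fun_const_smul _

/-- The second `s`-derivative of `s P` is `s Pₛₛ + 2 Pₛ`. The mean of `2 Pₛ` is twice the solution,
and its contribution cancels the derivative of the prefactor `(2t)⁻¹`. -/
theorem hasDerivAt_heatSolution_time (hv : Differentiable ℝ v)
    (hbv : ConeSubgaussian fun _ _ => v) (hbv' : ConeSubgaussian fun _ _ => deriv v)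
    {t : ℝ} (ht : 0 < t) (X : ℝ) :
    HasDerivAt (fun τ => heatSolution a v τ X)
      ((2 * t)⁻¹ • gaussMean (fun s X => s • waveSS a v s X) t X) t := by
  have hP := subgaussian_wave a hbv
  have hP' := subgaussian_waveS a hbv
  have hP'' := subgaussian_waveSS a hbv hbv'
  have hd1 : ∀ s X, HasDerivAt (fun σ => σ • wave a v σ X)
      (s • waveS a v s X + wave a v s X) s := fun s X => by
    simpa using! (hasDerivAt_id s).fun_smul (hasDerivAt_wave_s a hv.continuous s X)
  have hd2 : ∀ s X, HasDerivAt (fun σ => σ • waveS a v σ X + wave a v σ X)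
      (s • waveSS a v s X + (2 : ℝ) • waveS a v s X) s := fun s X => by
    have h := ((hasDerivAt_id s).fun_smul (hasDerivAt_waveS a hv.continuous hv s X)).fun_add
      (hasDerivAt_wave_s a hv.continuous s X)
    refine h.congr_deriv ?_
    simp only [id, one_smul, two_smul]
    abel
  have h1 := hasDerivAt_gaussMean_time (subgaussian_fst.smul hP)
    ((subgaussian_fst.smul hP').add hP)
    ((subgaussian_fst.smul hP'').add (hP'.const_smul 2)) hd1 hd2 ht X
  have h0 : HasDerivAt (fun τ : ℝ => (2 * τ)⁻¹) (-2 / (2 * t) ^ 2) t := by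
    have := ((hasDerivAt_id t).const_mul 2).fun_inv (by simpa using ht.ne')
    simpa using! this
  have h2 := h0.fun_smul h1
  have he : (fun τ => heatSolution a v τ X) =ᶠ[𝓝 t]
      fun τ => (2 * τ)⁻¹ • gaussMean (fun s X => s • wave a v s X) τ X := by
    filter_upwards [lt_mem_nhds ht] with τ hτ using heatSolution_eq a hv.continuous hbv hτ X
  refine (h2.congr_of_eventuallyEq he).congr_deriv ?_
  rw [gaussMean_add (subgaussian_fst.smul hP'') (hP'.const_smul 2),
    gaussMean_const_smul (waveS a v) (fun _ => 2)]
  change _ • (_ + (2 : ℝ) • heatSolution a v t X) + _ = _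
  rw [heatSolution_eq a hv.continuous hbv ht, smul_add, add_assoc, smul_smul, smul_smul, ← add_smul,
    show (2 * t)⁻¹ * 2 * (2 * t)⁻¹ + -2 / (2 * t) ^ 2 = 0 by field_simp; ring, zero_smul,
    add_zero]

theorem gaussMean_waveSS (hv : Differentiable ℝ v)
    (hbv : ConeSubgaussian fun _ _ => v) (hbv' : ConeSubgaussian fun _ _ => deriv v) (t X : ℝ) :
    gaussMean (fun s X => s • waveSS a v s X) t X =
      gaussMean (fun s X => s • waveXX a v s X) t X -
        (a ^ 2 * Real.exp (2 * X)) • gaussMean (fun s X => s • wave a v s X) t X := by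
  have hW := subgaussian_fst.smul (subgaussian_wave a hbv)
  have hq : Subgaussian fun s X => (a ^ 2 * Real.exp (2 * X)) • (s • wave a v s X) :=
    (coneSubgaussian_exp_two_mul (a ^ 2)).comp_add.smul hW
  rw [← gaussMean_const_smul _ fun X => a ^ 2 * Real.exp (2 * X), eq_sub_iff_add_eq,
    ← gaussMean_add (subgaussian_fst.smul (subgaussian_waveSS a hbv hbv')) hq]
  congr 1
  funext s X
  rw [wave_equation a hv.continuous, smul_sub, smul_comm s, sub_add_cancel]

theorem continuousOn_inv_smul_gaussMean {Q : ℝ → ℝ → ℂ} (hQ : Subgaussian Q) :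
    ContinuousOn (fun p : ℝ × ℝ => (2 * p.1)⁻¹ • gaussMean (fun s X => s • Q s X) p.1 p.2)
      (Ioi 0 ×ˢ univ) := by
  have h2 : ContinuousOn (fun p : ℝ × ℝ => 2 * p.1) (Ioi 0 ×ˢ univ) := by fun_prop
  refine ContinuousOn.smul (h2.inv₀ ?_)
    (subgaussian_fst.smul hQ).continuous_gaussMean.continuousOn
  rintro ⟨t, X⟩ ⟨ht, _⟩
  exact (mul_pos two_pos ht).ne'

theorem isClassicalSolution_heatSolution (hv : Differentiable ℝ v)
    (hbv : ConeSubgaussian fun _ _ => v) (hbv' : ConeSubgaussian fun _ _ => deriv v) :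
    IsClassicalSolution a v (heatSolution a v) where
  continuousOn := (subgaussian_waveS a hbv).continuous_gaussMean.continuousOn
  initial X := by rw [heatSolution, gaussMean_zero_left, waveS_zero]
  differentiableAt_time t ht X :=
    (hasDerivAt_heatSolution_time a hv hbv hbv' ht X).differentiableAt
  contDiff_space t ht := by
    have h1 := hasDerivAt_heatSolution_space a hv.continuous hbv ht
    have h2 := hasDerivAt_heatSolution_space_two a hv hbv hbv' ht
    rw [show (2 : WithTop ℕ∞) = 1 + 1 by norm_num, contDiff_succ_iff_deriv]
    refine ⟨fun X => (h1 X).differentiableAt, by simp, ?_⟩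
    rw [contDiff_one_iff_deriv]
    refine ⟨fun X => (h2 X).differentiableAt, ?_⟩
    rw [funext fun X => (h2 X).deriv]
    exact ((subgaussian_fst.smul (subgaussian_waveXX a hbv hbv')).continuous_gaussMean.comp
      (Continuous.prodMk_right t)).const_smul (2 * t)⁻¹
  continuousOn_time_deriv :=
    (continuousOn_inv_smul_gaussMean (subgaussian_waveSS a hbv hbv')).congr fun p hp =>
      (hasDerivAt_heatSolution_time a hv hbv hbv' hp.1 p.2).deriv
  continuousOn_space_deriv :=
    (continuousOn_inv_smul_gaussMean (subgaussian_waveX a hbv)).congr fun p hp =>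
      (hasDerivAt_heatSolution_space a hv.continuous hbv hp.1 p.2).deriv
  continuousOn_space_deriv_two :=
    (continuousOn_inv_smul_gaussMean (subgaussian_waveXX a hbv hbv')).congr fun p hp =>
      (hasDerivAt_heatSolution_space_two a hv hbv hbv' hp.1 p.2).deriv
  equation t ht X := by
    rw [morseOperator, (hasDerivAt_heatSolution_space_two a hv hbv hbv' ht X).deriv,
      (hasDerivAt_heatSolution_time a hv hbv hbv' ht X).deriv,
      gaussMean_waveSS a hv hbv hbv', heatSolution_eq a hv.continuous hbv ht, smul_sub,
      smul_comm (2 * t)⁻¹ (a ^ 2 * Real.exp (2 * X)), Complex.real_smul (x := a ^ 2 * _)]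

end Existence

/-! ### Uniqueness -/

/-- A real-linear functional commutes with the derivatives and with the real potential, so it
reduces the complex difference to the scalar maximum principle. -/
theorem IsClassicalSolution.apply_sub_nonpos {a : ℝ} {v : ℝ → ℂ} {V W : ℝ → ℝ → ℂ}
    (hV : IsClassicalSolution a v V) (hVg : HasTychonoffGrowth V)
    (hW : IsClassicalSolution a v W) (hWg : HasTychonoffGrowth W) (L : ℂ →L[ℝ] ℝ) {t : ℝ}
    (ht : 0 ≤ t) (X : ℝ) : L (W t X - V t X) ≤ 0 := by
  -- The horizon `t + 1` is positive even when `t = 0`.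
  obtain ⟨C, c, hC⟩ := hVg (t + 1) (by linarith)
  obtain ⟨D, d, hD⟩ := hWg (t + 1) (by linarith)
  have hdiff : ∀ {U : ℝ → ℝ → ℂ}, IsClassicalSolution a v U → ∀ t, 0 < t →
      Differentiable ℝ (U t) ∧ Differentiable ℝ (deriv (U t)) := fun {U} hU t ht => by
    have h : ContDiff ℝ (1 + 1) (U t) := by norm_num; exact hU.contDiff_space t ht
    exact ⟨(hU.contDiff_space t ht).differentiable (by norm_num),
      (contDiff_succ_iff_deriv.1 h).2.2.differentiable (by norm_num)⟩
  have hLd : ∀ {f g : ℝ → ℂ} {x : ℝ}, DifferentiableAt ℝ f x → DifferentiableAt ℝ g x →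
      HasDerivAt (fun y => L (f y - g y)) (L (deriv f x - deriv g x)) x := fun hf hg =>
    L.hasFDerivAt.comp_hasDerivAt _ (hf.hasDerivAt.fun_sub hg.hasDerivAt)
  refine nonpos_of_growth (q := fun X => a ^ 2 * Real.exp (2 * X)) (fun X => by positivity)
    (u := fun t X => L (W t X - V t X)) (T := t + 1) (C := ‖L‖ * (|C| + |D|)) (c := |c| + |d|)
    ?_ ?_ ?_ ?_ ?_ ?_ t ⟨ht, by linarith⟩ X
  · exact L.continuous.comp_continuousOn (hW.continuousOn.sub hV.continuousOn)
  · intro X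
    simp [hW.initial, hV.initial]
  · intro t ht X
    exact (hLd (hW.differentiableAt_time t ht X) (hV.differentiableAt_time t ht X)).differentiableAt
  · intro t ht
    exact L.contDiff.comp ((hW.contDiff_space t ht).sub (hV.contDiff_space t ht))
  · intro t ht X
    obtain ⟨hV1, hV2⟩ := hdiff hV t ht
    obtain ⟨hW1, hW2⟩ := hdiff hW t ht
    rw [(hLd (hW.differentiableAt_time t ht X) (hV.differentiableAt_time t ht X)).deriv,
      funext fun X => (hLd (hW1 X) (hV1 X)).deriv, (hLd (hW2 X) (hV2 X)).deriv,
      ← hW.equation t ht X, ← hV.equation t ht X]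
    unfold morseOperator
    rw [← smul_eq_mul (a ^ 2 * _), ← L.map_smul, ← L.map_sub, Complex.real_smul]
    congr 1
    ring
  · intro t ht X
    have h1 : ∀ {E e : ℝ}, (e ≤ |c| + |d|) →
        E * Real.exp (e * X ^ 2) ≤ |E| * Real.exp ((|c| + |d|) * X ^ 2) := fun {E e} he =>
      mul_le_mul (le_abs_self E) (Real.exp_le_exp.2 (mul_le_mul_of_nonneg_right he (sq_nonneg X)))
        (Real.exp_pos _).le (abs_nonneg E)
    have hV' := (hC t ht X).trans (h1 (by linarith [le_abs_self c, abs_nonneg d]))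
    have hW' := (hD t ht X).trans (h1 (by linarith [le_abs_self d, abs_nonneg c]))
    calc L (W t X - V t X) ≤ ‖L (W t X - V t X)‖ := le_abs_self _
      _ ≤ ‖L‖ * (‖W t X‖ + ‖V t X‖) :=
        (L.le_opNorm _).trans (mul_le_mul_of_nonneg_left (norm_sub_le _ _) (norm_nonneg L))
      _ ≤ ‖L‖ * ((|C| + |D|) * Real.exp ((|c| + |d|) * X ^ 2)) := by
        gcongr
        linarith
      _ = _ := by ring

theorem IsClassicalSolution.unique {a : ℝ} {v : ℝ → ℂ} {V W : ℝ → ℝ → ℂ}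
    (hV : IsClassicalSolution a v V) (hVg : HasTychonoffGrowth V)
    (hW : IsClassicalSolution a v W) (hWg : HasTychonoffGrowth W) {t : ℝ} (ht : 0 ≤ t) (X : ℝ) :
    W t X = V t X := by
  have key : ∀ L : ℂ →L[ℝ] ℝ, L (W t X) = L (V t X) := fun L => by
    have h1 := hV.apply_sub_nonpos hVg hW hWg L ht X
    have h2 := hW.apply_sub_nonpos hWg hV hVg L ht X
    rw [map_sub] at h1 h2
    linarith
  exact Complex.ext (key Complex.reCLM) (key Complex.imCLM)

end MorseHeat

end

/-! ### The theorem -/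

theorem mainTheorem9 (a : ℝ) (V₀ : ℝ → ℂ) (hV₀ : ContDiff ℝ ∞ V₀)
    (hsupp : HasCompactSupport V₀) :
    (∀ t, 0 < t → ∀ X X' : ℝ,
      IntegrableOn (fun s => MorseHeat.heatIntegrand a t X X' s) (Ioi |X - X'|)) ∧
    (∀ t, 0 < t → ∀ X : ℝ,
      Integrable (fun X' : ℝ => (MorseHeat.heatKernel a t X X' : ℂ) * V₀ X')) ∧
    ∃ V : ℝ → ℝ → ℂ,
      MorseHeat.IsClassicalSolution a V₀ V ∧
      MorseHeat.HasTychonoffGrowth V ∧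
      (∀ t, 0 < t → ∀ X : ℝ,
        V t X = ∫ X' : ℝ, (MorseHeat.heatKernel a t X X' : ℂ) * V₀ X') ∧
      ∀ W : ℝ → ℝ → ℂ, MorseHeat.IsClassicalSolution a V₀ W → MorseHeat.HasTychonoffGrowth W →
        ∀ t, 0 ≤ t → ∀ X : ℝ, W t X = V t X := by
  have hc : Continuous V₀ := hV₀.continuous
  have hd : Differentiable ℝ V₀ := hV₀.differentiable (by simp)
  have hc' : Continuous (deriv V₀) := hV₀.continuous_deriv (by simp)
  have hi : Integrable V₀ := hc.integrable_of_hasCompactSupport hsupp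
  obtain ⟨M, hM⟩ := hc.bounded_above_of_compact_support hsupp
  obtain ⟨M', hM'⟩ := hc'.bounded_above_of_compact_support hsupp.deriv
  have hb := MorseHeat.ConeSubgaussian.of_bounded hc hM
  have hb' := MorseHeat.ConeSubgaussian.of_bounded hc' hM'
  have hsol := MorseHeat.isClassicalSolution_heatSolution a hd hb hb'
  have hgrowth : MorseHeat.HasTychonoffGrowth (MorseHeat.heatSolution a V₀) := fun T _ => by
    obtain ⟨C, hC⟩ := MorseHeat.norm_heatSolution_le a hc hM
    exact ⟨C, 0, fun t ht X => by simpa using hC t ht.1 X⟩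
  refine ⟨fun t ht X X' => (MorseHeat.integrable_heatIntegrand a X X' ht).integrableOn,
    fun t ht X => MorseHeat.integrable_heatKernel_mul a X ht hc hi,
    MorseHeat.heatSolution a V₀, hsol, hgrowth, fun t ht X => ?_,
    fun W hW hWg t ht X => hsol.unique hgrowth hW hWg ht X⟩
  rw [MorseHeat.integral_heatKernel_mul a X ht hc hi hb, MorseHeat.heatSolution_eq a hc hb ht]
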